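/- Let $n \ge 1$ and let $\pi$ be a probability distribution on $[n]=\{1,\dots,n\}$ with $\pi(i)>0$ for every $i\in[n]$. Let $$\mathcal{B}_\pi=\Big\{X\in\mathbb{R}^{n-1}:\ 0\le X[i]\le\min\Big(1-\tfrac{\pi(i-1)}{\pi(i)}X[i-1],\ \tfrac{\pi(i+1)}{\pi(i)}(1-X[i+1])\Big),\ 1\le i\le n-1\Big\},$$ with the convention $X[0]=X[n]=0$. This is the set of super-diagonals of tridiagonal stochastic $n\times n$ matrices reversible with respect to $\pi$. Let $U_\pi$ be the uniform distribution on $\mathcal{B}_\pi$. For an integer $k>0$, a real weight $w>0$ and $n\ge k+2$, the block Gibbs sampler $(X_t)_{t\ge 0}$ is the following Markov chain on $\mathcal{B}_\pi$. At each step choose $i\in\{1,\dots,n-k\}$ with probability $\frac{w}{n-k-2+2w}$ if $i\in\{1,n-k\}$ and with probability $\frac{1}{n-k-2+2w}$ otherwise. Then let $X_{t+1}$ be uniformly distributed on the convex set of all $U\in\mathcal{B}_\pi$ with $U[j]=X_t[j]$ for every $j\notin\{i,i+1,\dots,i+k-1\}$ (uniform with respect to Lebesgue measure on the affine hull of this set).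 Write $\mathcal{L}(X_t)$ for the law of $X_t$ and $\|\mu-\nu\|_{TV}=\sup_A|\mu(A)-\nu(A)|$. **Theorem.** 1. Let $k=w=55$, $n>58$, $c>0$, and let $t$ be an integer with $t>2cn\log n$. Then for every such $\pi$ and every starting point $X_0=x\in\mathcal{B}_\pi$, $$\|\mathcal{L}(X_t)-U_\pi\|_{TV}\le n^{1-c}.$$ 2. Conversely, let $k\ge1$ be an integer and let $w>0$ and $c>0$ be real. For each $n$ let $\pi_n$ be a distribution on $[n]$ with full support, let $x_n\in\mathcal{B}_{\pi_n}$, and let $X^{(n)}_t$ be the corresponding chain started at $x_n$. With $t_n=\max\big(0,\lfloor(\tfrac1k-c)\,n\log n\rfloor\big)$, $$\liminf_{n\to\infty}\big\|\mathcal{L}\big(X^{(n)}_{t_n}\big)-U_{\pi_n}\big\|_{TV}>0.$$ -/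

import Mathlib

open MeasureTheory ProbabilityTheory Filter

/-! ### Uniform distributions on coordinate slices -/

/-- The set of points of `S` which agree with `x` at every coordinate outside `J`. -/
def coordSlice {ι : Type} (S : Set (ι → ℝ)) (J : Set ι) (x : ι → ℝ) : Set (ι → ℝ) :=
  {y | y ∈ S ∧ ∀ j, j ∉ J → y j = x j}

/-- The uniform distribution on a bounded convex set `S`: normalized `d`-dimensional (Hausdorff)
volume on `S`, where `d` is the dimension of the affine hull of `S`. When `S` has nonempty
interior this is normalized Lebesgue measure; when `S` is a single point it is the point mass. -/
noncomputable def uniformMeasure {ι : Type} [Fintype ι] (S : Set (ι → ℝ)) : Measure (ι → ℝ) :=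
  ProbabilityTheory.cond (μH[(Module.finrank ℝ (vectorSpan ℝ S) : ℝ)]) S

/-- Total variation distance, `sup_A |μ(A) - ν(A)|` over measurable sets `A`. -/
noncomputable def tvDist {Ω : Type} [MeasurableSpace Ω] (μ ν : Measure Ω) : ℝ :=
  ⨆ A : {A : Set Ω // MeasurableSet A}, |μ.real A.1 - ν.real A.1|

/-! ### The polytope and the block Gibbs sampler -/

/-- `π(1), …, π(n)` is a probability distribution on `[n] = {1, …, n}` with support equal to `[n]`
(the values of `π` outside `[n]` play no role). -/
def IsFullDistribution (n : ℕ) (π : ℕ → ℝ) : Prop :=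
  (∀ i ∈ Finset.Icc 1 n, 0 < π i) ∧ ∑ i ∈ Finset.Icc 1 n, π i = 1

/-- The entry `X[i]`, `1 ≤ i ≤ n - 1`, of a vector `X ∈ ℝ^(n-1)`, with the convention
`X[0] = X[n] = 0`. -/
def entry {n : ℕ} (X : Fin (n - 1) → ℝ) (i : ℕ) : ℝ :=
  if h : 1 ≤ i ∧ i ≤ n - 1 then X ⟨i - 1, by omega⟩ else 0

/-- The polytope `B_π ⊆ ℝ^(n-1)` of super-diagonals of tridiagonal stochastic matrices which are
reversible with respect to `π`. -/
def bdPolytope (n : ℕ) (π : ℕ → ℝ) : Set (Fin (n - 1) → ℝ) :=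
  {X | ∀ i ∈ Finset.Icc 1 (n - 1), 0 ≤ entry X i ∧
    entry X i ≤ min (1 - π (i - 1) / π i * entry X (i - 1))
      (π (i + 1) / π i * (1 - entry X (i + 1)))}

/-- The uniform distribution `U_π` on `B_π`: normalized Lebesgue measure. -/
noncomputable def bdUniform (n : ℕ) (π : ℕ → ℝ) : Measure (Fin (n - 1) → ℝ) :=
  ProbabilityTheory.cond volume (bdPolytope n π)

/-- The block of coordinates `{i, i + 1, …, i + k - 1}` (the index `j : Fin (n - 1)` stands for
the coordinate `j + 1 ∈ {1, …, n - 1}`). -/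
def block (n k i : ℕ) : Set (Fin (n - 1)) :=
  {j | i ≤ (j : ℕ) + 1 ∧ (j : ℕ) + 1 ≤ i + k - 1}

/-- The probability with which the block starting at `i ∈ {1, …, n - k}` is chosen. -/
noncomputable def blockProb (n k : ℕ) (w : ℝ) (i : ℕ) : ℝ :=
  if i = 1 ∨ i = n - k then w / ((n : ℝ) - k - 2 + 2 * w) else 1 / ((n : ℝ) - k - 2 + 2 * w)

/-- One step of the block Gibbs sampler from `x`: choose the starting point `i ∈ {1, …, n - k}` of a
block with probability `blockProb n k w i`, and draw the new state uniformly from the points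
of `B_π` that agree with `x` outside the block. -/
noncomputable def blockStep (n k : ℕ) (w : ℝ) (π : ℕ → ℝ) (x : Fin (n - 1) → ℝ) :
    Measure (Fin (n - 1) → ℝ) :=
  ∑ i ∈ Finset.Icc 1 (n - k), ENNReal.ofReal (blockProb n k w i) •
    uniformMeasure (coordSlice (bdPolytope n π) (block n k i) x)

/-- The law of the block Gibbs sampler after `t` steps, started at `x`. -/
noncomputable def blockLaw (n k : ℕ) (w : ℝ) (π : ℕ → ℝ) (x : Fin (n - 1) → ℝ) :
    ℕ → Measure (Fin (n - 1) → ℝ)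
  | 0 => Measure.dirac x
  | t + 1 => (blockLaw n k w π x t).bind (blockStep n k w π)

/-! ### The one-step law is a measurable function of the state, as `Measure.bind` requires -/

section Measurability

/-- The coordinates in `J` that are not forced to vanish on the slice through `x`. -/
def freeCoords {ι : Type} (S : Set (ι → ℝ)) (J : Set ι) (x : ι → ℝ) : Set ι :=
  {j | j ∈ J ∧ ∃ y ∈ coordSlice S J x, y j ≠ 0}

open Classical in
/-- The point with coordinates `u` on `F`, `0` on the rest of `J`, and `x` outside `J`. -/
noncomputable def glue {ι : Type} (F J : Set ι) (x : ι → ℝ) (u : F → ℝ) : ι → ℝ :=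
  fun j => if h : j ∈ F then u ⟨j, h⟩ else if j ∈ J then 0 else x j

theorem isometry_glue {ι : Type} [Fintype ι] (F J : Set ι) [Fintype F] (x : ι → ℝ) :
    Isometry (glue F J x) := by
  refine Isometry.of_dist_eq fun u v => le_antisymm ?_ ?_
  · refine (dist_pi_le_iff dist_nonneg).2 fun j => ?_
    by_cases h : j ∈ F
    · simpa [glue, h] using dist_le_pi_dist u v ⟨j, h⟩
    · simp [glue, h]
  · refine (dist_pi_le_iff dist_nonneg).2 fun j => ?_
    have := dist_le_pi_dist (glue F J x u) (glue F J x v) j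
    simpa [glue] using this

theorem measurable_glue {ι : Type} [Fintype ι] (F J : Set ι) :
    Measurable fun p : (ι → ℝ) × (F → ℝ) => glue F J p.1 p.2 := by
  refine measurable_pi_lambda _ fun j => ?_
  by_cases h : j ∈ F
  · simp only [glue, h, dite_true]
    fun_prop
  · by_cases h' : j ∈ J
    · simp only [glue, h, h', dite_false, if_true]
      fun_prop
    · simp only [glue, h, h', dite_false, if_false]
      fun_prop

/-- `S` is a measurable set of nonnegative vectors, closed under decreasing coordinates. -/
structure IsDownSet {ι : Type} [Fintype ι] (S : Set (ι → ℝ)) : Prop where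
  meas : MeasurableSet S
  nonneg : ∀ y ∈ S, ∀ j, 0 ≤ y j
  down : ∀ y ∈ S, ∀ z : ι → ℝ, (∀ j, 0 ≤ z j) → (∀ j, z j ≤ y j) → z ∈ S

theorem measurableSet_coordSlice {ι : Type} [Fintype ι] {S : Set (ι → ℝ)} (hS : IsDownSet S)
    (J : Set ι) (x : ι → ℝ) : MeasurableSet (coordSlice S J x) := by
  have : coordSlice S J x = S ∩ ⋂ j : ι, {y | j ∉ J → y j = x j} := by
    ext y; simp [coordSlice]
  rw [this]
  refine hS.meas.inter (MeasurableSet.iInter fun j => ?_)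
  by_cases h : j ∈ J
  · simp [h]
  · simpa [h] using measurableSet_eq_fun (measurable_pi_apply j) measurable_const

open Classical in
theorem finrank_vectorSpan_coordSlice {ι : Type} [Fintype ι] {S : Set (ι → ℝ)}
    (hS : IsDownSet S) (J : Set ι) (x : ι → ℝ) :
    Module.finrank ℝ (vectorSpan ℝ (coordSlice S J x)) = Fintype.card (freeCoords S J x) := by
  set F := freeCoords S J x with hF
  have hrange : vectorSpan ℝ (coordSlice S J x)
      = Submodule.span ℝ (Set.range fun j : F => Pi.single (M := fun _ : ι => ℝ) j.1 1) := by
    apply le_antisymm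
    · rw [vectorSpan_def, Submodule.span_le]
      rintro _ ⟨y, hy, z, hz, rfl⟩
      have key : ∀ j, j ∉ F → (y - z) j = 0 := by
        intro j hj
        by_cases hJ : j ∈ J
        · have h1 : y j = 0 := by
            by_contra h
            exact hj ⟨hJ, y, hy, h⟩
          have h2 : z j = 0 := by
            by_contra h
            exact hj ⟨hJ, z, hz, h⟩
          simp [h1, h2]
        · simp [hy.2 j hJ, hz.2 j hJ]
      have hsum : y - z = ∑ j, (y - z) j • Pi.single (M := fun _ : ι => ℝ) j 1 := by
        ext i
        simp [Finset.sum_apply, Pi.single_apply]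
      change y - z ∈ Submodule.span ℝ _
      rw [hsum]
      refine Submodule.sum_mem _ fun j _ => ?_
      by_cases hj : j ∈ F
      · exact Submodule.smul_mem _ _ (Submodule.subset_span ⟨⟨j, hj⟩, rfl⟩)
      · rw [key j hj, zero_smul]
        exact Submodule.zero_mem _
    · rw [Submodule.span_le]
      rintro _ ⟨⟨j, hJ, y, hy, hne⟩, rfl⟩
      have hz : Function.update y j 0 ∈ coordSlice S J x := by
        refine ⟨hS.down y hy.1 _ ?_ ?_, ?_⟩
        · intro i
          by_cases h : i = j
          · subst h; simp
          · simpa [h] using hS.nonneg y hy.1 i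
        · intro i
          by_cases h : i = j
          · subst h; simpa using hS.nonneg y hy.1 i
          · simp [h]
        · intro i hi
          have : i ≠ j := fun h => hi (h ▸ hJ)
          simpa [this] using hy.2 i hi
      have hmem := vsub_mem_vectorSpan ℝ hy hz
      have heq : y -ᵥ Function.update y j 0 = y j • Pi.single (M := fun _ : ι => ℝ) j 1 := by
        ext i
        by_cases h : i = j
        · subst h; simp
        · simp [h]
      rw [heq] at hmem
      exact (Submodule.smul_mem_iff _ hne).1 hmem
  rw [hrange, finrank_span_eq_card]
  have := (Pi.basisFun ℝ ι).linearIndependent.comp (fun j : F => j.1) Subtype.val_injective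
  convert this using 2
  simp

open Classical in
/-- On a slice, the uniform distribution is normalized Lebesgue measure in the free
coordinates. -/
theorem uniformMeasure_coordSlice_apply {ι : Type} [Fintype ι] {S : Set (ι → ℝ)}
    (hS : IsDownSet S) (J : Set ι) (x : ι → ℝ) {A : Set (ι → ℝ)} (F : Set ι)
    (hF : freeCoords S J x = F) :
    uniformMeasure (coordSlice S J x) A =
      (volume (glue F J x ⁻¹' S))⁻¹ * volume (glue F J x ⁻¹' (S ∩ A)) := by
  have hFJ : F ⊆ J := by rw [← hF]; exact fun j hj => hj.1
  have hval : ∀ T : Set (ι → ℝ), μH[(Fintype.card F : ℝ)] (coordSlice S J x ∩ T)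
      = volume (glue F J x ⁻¹' (S ∩ T)) := by
    intro T
    have hsub : coordSlice S J x ∩ T ⊆ Set.range (glue F J x) := by
      rintro y ⟨hy, -⟩
      refine ⟨fun j => y j, funext fun j => ?_⟩
      by_cases h : j ∈ F
      · simp [glue, h]
      · by_cases hJ : j ∈ J
        · have : y j = 0 := by
            by_contra h'
            exact h (hF ▸ ⟨hJ, y, hy, h'⟩)
          simp [glue, h, hJ, this]
        · simp [glue, h, hJ, hy.2 j hJ]
    have hpre : glue F J x ⁻¹' (coordSlice S J x ∩ T) = glue F J x ⁻¹' (S ∩ T) := by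
      ext u
      have : ∀ j, j ∉ J → glue F J x u j = x j := fun j hj => by
        have : j ∉ F := fun h => hj (hFJ h)
        simp [glue, hj, this]
      simp only [Set.mem_preimage, Set.mem_inter_iff, coordSlice, Set.mem_ofPred_eq]
      tauto
    rw [← hpre, ← hausdorffMeasure_pi_real,
      (isometry_glue F J x).hausdorffMeasure_preimage (Or.inl (by positivity)),
      Set.inter_eq_self_of_subset_left hsub]
  subst hF
  rw [uniformMeasure, cond_apply (measurableSet_coordSlice hS J x),
    finrank_vectorSpan_coordSlice hS, hval A]
  have := hval Set.univ
  rw [Set.inter_univ, Set.inter_univ] at this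
  rw [this]

open Classical in
theorem measurableSet_freeCoords_eq {ι : Type} [Fintype ι] {S : Set (ι → ℝ)}
    (hS : IsDownSet S) (J F : Set ι) : MeasurableSet {x | freeCoords S J x = F} := by
  have h1 : ∀ j, MeasurableSet {x : ι → ℝ | j ∈ freeCoords S J x} := by
    intro j
    by_cases hJ : j ∈ J
    swap
    · simp [freeCoords, hJ]
    have : {x : ι → ℝ | j ∈ freeCoords S J x} = ⋃ m : ℕ,
        (fun x i => if i = j then 1 / ((m : ℝ) + 1) else if i ∈ J then 0 else x i) ⁻¹' S := by
      ext x
      simp only [Set.mem_ofPred_eq, Set.mem_iUnion, Set.mem_preimage]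
      constructor
      · rintro ⟨-, y, hy, hne⟩
        have hpos : 0 < y j := lt_of_le_of_ne (hS.nonneg y hy.1 j) (Ne.symm hne)
        obtain ⟨m, hm⟩ := exists_nat_one_div_lt hpos
        refine ⟨m, hS.down y hy.1 _ ?_ ?_⟩
        · intro i
          split_ifs with ha hb
          · positivity
          · exact le_rfl
          · rw [← hy.2 i hb]; exact hS.nonneg y hy.1 i
        · intro i
          split_ifs with ha hb
          · subst ha; exact hm.le
          · exact hS.nonneg y hy.1 i
          · exact (hy.2 i hb).ge
      · rintro ⟨m, hm⟩
        refine ⟨hJ, _, ⟨hm, fun i hi => ?_⟩, ?_⟩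
        · have : i ≠ j := fun h => hi (h ▸ hJ)
          simp [this, hi]
        · simp only [if_true]
          positivity
    rw [this]
    refine MeasurableSet.iUnion fun m => hS.meas.preimage ?_
    refine measurable_pi_lambda _ fun i => ?_
    split_ifs
    · exact measurable_const
    · exact measurable_const
    · exact measurable_pi_apply i
  have : {x | freeCoords S J x = F} = ⋂ j : ι, {x | j ∈ freeCoords S J x ↔ j ∈ F} := by
    ext x; simp [Set.ext_iff]
  rw [this]
  refine MeasurableSet.iInter fun j => ?_
  by_cases h : j ∈ F
  · simpa [h] using h1 j
  · have h2 := (h1 j).compl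
    convert h2 using 1
    ext x
    simp [h]

theorem measurable_uniformMeasure_coordSlice {ι : Type} [Fintype ι] {S : Set (ι → ℝ)}
    (hS : IsDownSet S) (J : Set ι) :
    Measurable fun x => uniformMeasure (coordSlice S J x) := by
  classical
  refine Measure.measurable_of_measurable_coe _ fun A hA => ?_
  have hg : ∀ (F : Set ι) (T : Set (ι → ℝ)), MeasurableSet T →
      Measurable fun x => volume (glue F J x ⁻¹' T) := fun F T hT =>
    measurable_measure_prodMk_left (ν := (volume : Measure (F → ℝ)))
      (hT.preimage (measurable_glue F J))
  have heq : (fun x => uniformMeasure (coordSlice S J x) A) = fun x => ∑ F : Set ι,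
      Set.indicator {x | freeCoords S J x = F} (fun x => (volume (glue F J x ⁻¹' S))⁻¹ *
        volume (glue F J x ⁻¹' (S ∩ A))) x := by
    funext x
    rw [Finset.sum_eq_single (freeCoords S J x)]
    · rw [Set.indicator_of_mem (by simp)]
      exact uniformMeasure_coordSlice_apply hS J x _ rfl
    · intro F _ hF
      have hx : x ∉ {x | freeCoords S J x = F} := fun h => hF (Eq.symm h)
      rw [Set.indicator_of_notMem hx]
    · simp
  rw [heq]
  refine Finset.measurable_sum _ fun F _ => Measurable.indicator ?_
    (measurableSet_freeCoords_eq hS J F)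
  exact (hg F S hS.meas).inv.mul (hg F _ (hS.meas.inter hA))

theorem entry_succ {n : ℕ} (X : Fin (n - 1) → ℝ) (j : Fin (n - 1)) :
    entry X ((j : ℕ) + 1) = X j := by
  have : 1 ≤ (j : ℕ) + 1 ∧ (j : ℕ) + 1 ≤ n - 1 := by omega
  simp [entry, this]

theorem isDownSet_bdPolytope {n : ℕ} {π : ℕ → ℝ} (hπ : IsFullDistribution n π) :
    IsDownSet (bdPolytope n π) := by
  have hent : ∀ i, Measurable fun X : Fin (n - 1) → ℝ => entry X i := by
    intro i
    unfold entry
    split_ifs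
    · exact measurable_pi_apply _
    · exact measurable_const
  have hπ' : ∀ i, 1 ≤ i → i ≤ n → 0 < π i := fun i h1 h2 => hπ.1 i (Finset.mem_Icc.2 ⟨h1, h2⟩)
  refine ⟨?_, ?_, ?_⟩
  · have : bdPolytope n π = ⋂ i ∈ Finset.Icc 1 (n - 1), {X | 0 ≤ entry X i ∧
        entry X i ≤ min (1 - π (i - 1) / π i * entry X (i - 1))
          (π (i + 1) / π i * (1 - entry X (i + 1)))} := by
      ext X; simp [bdPolytope]
    rw [this]
    refine Finset.measurableSet_biInter _ fun i _ => ?_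
    exact (measurableSet_le measurable_const (hent i)).inter (measurableSet_le (hent i)
      ((measurable_const.sub ((hent _).const_mul _)).min
        ((measurable_const.sub (hent _)).const_mul _)))
  · intro y hy j
    have := (hy ((j : ℕ) + 1) (Finset.mem_Icc.2 (by omega))).1
    rwa [entry_succ] at this
  · intro y hy z h0 hle
    have e0 : ∀ i, 0 ≤ entry z i := by
      intro i; unfold entry; split_ifs
      · exact h0 _
      · exact le_rfl
    have e1 : ∀ i, entry z i ≤ entry y i := by
      intro i; unfold entry; split_ifs
      · exact hle _
      · exact le_rfl
    intro i hi
    obtain ⟨hi1, hi2⟩ := Finset.mem_Icc.1 hi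
    refine ⟨e0 i, (e1 i).trans ((hy i hi).2.trans (min_le_min ?_ ?_))⟩
    · rcases Nat.eq_or_lt_of_le hi1 with h | h
      · subst h; simp [entry]
      · have := mul_le_mul_of_nonneg_left (e1 (i - 1))
          (div_pos (hπ' (i - 1) (by omega) (by omega)) (hπ' i hi1 (by omega))).le
        linarith
    · exact mul_le_mul_of_nonneg_left (by linarith [e1 (i + 1)])
        (div_pos (hπ' (i + 1) (by omega) (by omega)) (hπ' i hi1 (by omega))).le

theorem measurable_blockStep {n : ℕ} (k : ℕ) (w : ℝ) {π : ℕ → ℝ}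
    (hπ : IsFullDistribution n π) : Measurable (blockStep n k w π) := by
  refine Measure.measurable_of_measurable_coe _ fun A hA => ?_
  simp only [blockStep, Measure.finsetSum_apply, Measure.smul_apply, smul_eq_mul]
  refine Finset.measurable_sum _ fun i _ => Measurable.const_mul ?_ _
  exact (Measure.measurable_coe hA).comp
    (measurable_uniformMeasure_coordSlice (isDownSet_bdPolytope hπ) (block n k i))

end Measurability

/-! Upper bound: path coupling in dual form. Instead of coupling two chains, follow test functions:
`CoordLip c f` says that changing coordinate `j` inside the polytope changes `f` by at most `c j`,
and one shows that the transition operator shrinks a suitable weight vector `c` by a fixed factor. A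
change at `j` is forgotten when the chosen block contains `j`, and persists unchanged when the block
does not touch `j`. It spreads only when the block is adjacent to `j`.

In coordinates, `B_π` is cut out by box constraints and by one constraint `a i * x i + a j * x j ≤ r
i j` for each adjacent pair. Raising the boundary coordinate `i` therefore just conditions the law
of the block on a smaller value at the neighbour `m` (`gibbs_restrict_of_adj`). Given all other
coordinates, a coordinate is uniform on an interval starting at `0`. Hence a discrepancy of larger
value `y` is passed on with probability at most `a y / r` (`gibbs_tail_le`), and the mean of `a y`
is at most `r / 2` (`lintegral_gibbs_mul_le`). So a discrepancy may be sure to reach the first site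
of the block, but it passes from there to the second with probability at most `1/2`, and so on in
steps of two sites (`within_gibbs_pathBlock`). With unit weights, at most `3` new discrepancies are
expected, however long the block is (`spread_const_le`).

For `k = w = 55` every coordinate is covered at relative rate at least `55`. The heavy end blocks
spread discrepancies from the coordinates just beyond them, so these receive weight `10` instead of
`1` (or `19` if they coincide). `weighted_spread_le` balances gain against loss and leaves
contraction by `1 - 12 / (n + 53)` in each step. Stationarity of `U_π`, which follows from
consistency of the slice distributions (`bind_uniformMeasure_coordSlice`), then gives
`tvDist_blockLaw_le`.

Lower bound: coupon collecting. Take about `n / k` coordinates with spacing `k`, away from the ends.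
A block covers at most one of them, and each is covered with the same probability `p`. The chance
that all have been resampled after `t` steps is at most what independence would give
(`one_sub_pow_le_iterate_blockOp`). Up to the given time it stays below `exp (-1)`, whereas under
`U_π` no coordinate equals its starting value, almost surely. -/

open scoped ENNReal

/-! ### Gibbs kernels on down-sets -/

section DownSet

variable {ι : Type}

/-- The point `x` with the coordinates in `J` replaced by `0`. -/
noncomputable def zeroOn (J : Set ι) (x : ι → ℝ) : ι → ℝ :=
  open Classical in fun j => if j ∈ J then 0 else x j

open Classical in
theorem glue_eq_updateFinset (F : Finset ι) (J : Set ι) (x : ι → ℝ)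
    (u : ↥(F : Set ι) → ℝ) :
    glue (F : Set ι) J x u = Function.updateFinset (zeroOn J x) F u := by
  funext j
  by_cases h : j ∈ F
  · simp [glue, Function.updateFinset, h]
  · by_cases h' : j ∈ J <;> simp [glue, Function.updateFinset, zeroOn, h, h']

theorem freeCoords_subset (S : Set (ι → ℝ)) (J : Set ι) (x : ι → ℝ) : freeCoords S J x ⊆ J :=
  fun _ h => h.1

theorem coordSlice_congr (S : Set (ι → ℝ)) {J : Set ι} {x y : ι → ℝ} (h : ∀ j ∉ J, x j = y j) :
    coordSlice S J x = coordSlice S J y := by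
  ext z
  simp only [coordSlice, Set.mem_ofPred_eq]
  refine and_congr_right fun _ => forall₂_congr fun j hj => by rw [h j hj]

theorem coordSlice_mono (S : Set (ι → ℝ)) {J' J : Set ι} (hJ : J' ⊆ J) {x y : ι → ℝ}
    (hy : y ∈ coordSlice S J x) : coordSlice S J' y ⊆ coordSlice S J x := fun _ hz =>
  ⟨hz.1, fun j hj => (hz.2 j fun h => hj (hJ h)).trans (hy.2 j hj)⟩

/-- A point without vanishing free coordinates itself witnesses that they are free for the smaller
block. Hence the free set of `J'` is the same at almost all points of the slice, and a single
integral formula serves them all. -/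
theorem freeCoords_of_ne_zero {S : Set (ι → ℝ)} {J' J : Set ι} (hJ : J' ⊆ J) {x y : ι → ℝ}
    (hy : y ∈ coordSlice S J x) (h0 : ∀ j ∈ freeCoords S J x, y j ≠ 0) :
    freeCoords S J' y = freeCoords S J x ∩ J' := by
  ext j
  constructor
  · rintro ⟨hj, z, hz, hne⟩
    exact ⟨⟨hJ hj, z, coordSlice_mono S hJ hy hz, hne⟩, hj⟩
  · rintro ⟨hj, hj'⟩
    exact ⟨hj', y, ⟨hy.1, fun _ _ => rfl⟩, h0 j hj⟩

open Classical in
-- Passes to `lmarginal`, for which Fubini over a disjoint union of coordinate sets is available as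
-- `lmarginal_union`.
theorem volume_glue_preimage {F : Finset ι} {_ : Fintype ↥(F : Set ι)} {J : Set ι} (x : ι → ℝ)
    {A : Set (ι → ℝ)} (hA : MeasurableSet A) :
    volume (glue (F : Set ι) J x ⁻¹' A) =
      lmarginal (fun _ : ι => (volume : Measure ℝ)) F (A.indicator 1) (zeroOn J x) := by
  have h1 : Measurable (fun u : (F → ℝ) => Function.updateFinset (zeroOn J x) F u) :=
    measurable_updateFinset
  have : (fun u : (F → ℝ) => A.indicator (1 : (ι → ℝ) → ℝ≥0∞)
      (Function.updateFinset (zeroOn J x) F u)) =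
      ((fun u : (F → ℝ) => Function.updateFinset (zeroOn J x) F u) ⁻¹' A).indicator 1 := by
    ext u; simp [Set.indicator]
  rw [lmarginal, this, lintegral_indicator_one (h1 hA)]
  have h2 : (glue (F : Set ι) J x ⁻¹' A) =
      ((fun u : (F → ℝ) => Function.updateFinset (zeroOn J x) F u) ⁻¹' A) := by
    ext u
    simp only [Set.mem_preimage]
    rw [glue_eq_updateFinset]
  rw [h2, volume_pi]
  congr!

open Classical in
theorem lmarginal_mul_of_indep {F : Finset ι} {f g : (ι → ℝ) → ℝ≥0∞} (hf : Measurable f)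
    (hg : ∀ x y, (∀ j ∉ F, x j = y j) → g x = g y) (x : ι → ℝ) :
    lmarginal (fun _ : ι => (volume : Measure ℝ)) F (fun y => f y * g y) x =
      lmarginal (fun _ : ι => (volume : Measure ℝ)) F f x * g x := by
  rw [lmarginal, lmarginal]
  refine Eq.trans (lintegral_congr fun u => ?_)
    (lintegral_mul_const _ (hf.comp measurable_updateFinset))
  congr 1
  exact hg _ _ fun j hj => by simp [Function.updateFinset, hj]

variable [Fintype ι]

open Classical in
/-- The free coordinates as a finset. -/
noncomputable def freeFinset (S : Set (ι → ℝ)) (J : Set ι) (x : ι → ℝ) : Finset ι :=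
  (freeCoords S J x).toFinset

theorem coe_freeFinset (S : Set (ι → ℝ)) (J : Set ι) (x : ι → ℝ) :
    (freeFinset S J x : Set ι) = freeCoords S J x := by
  simp [freeFinset]

open Classical in
theorem uniformMeasure_coordSlice_eq_lmarginal {S : Set (ι → ℝ)} (hS : IsDownSet S) (J : Set ι)
    (x : ι → ℝ) {F : Finset ι} (hF : freeCoords S J x = F) {A : Set (ι → ℝ)}
    (hA : MeasurableSet A) :
    uniformMeasure (coordSlice S J x) A =
      (lmarginal (fun _ : ι => (volume : Measure ℝ)) F (S.indicator 1) (zeroOn J x))⁻¹ *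
        lmarginal (fun _ : ι => (volume : Measure ℝ)) F ((S ∩ A).indicator 1) (zeroOn J x) := by
  rw [uniformMeasure_coordSlice_apply hS J x F hF, volume_glue_preimage x hS.meas,
    volume_glue_preimage x (hS.meas.inter hA)]

open Classical in
theorem uniformMeasure_coordSlice_eq_smul {S : Set (ι → ℝ)} (hS : IsDownSet S) (J : Set ι)
    (x : ι → ℝ) {F : Finset ι} (hF : freeCoords S J x = F) :
    uniformMeasure (coordSlice S J x) =
      (lmarginal (fun _ : ι => (volume : Measure ℝ)) F (S.indicator 1) (zeroOn J x))⁻¹ •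
        ((Measure.pi fun _ : F => (volume : Measure ℝ)).map
          (Function.updateFinset (zeroOn J x) F)).restrict S := by
  ext A hA
  rw [uniformMeasure_coordSlice_eq_lmarginal hS J x hF hA, Measure.smul_apply, smul_eq_mul,
    Measure.restrict_apply hA, Set.inter_comm]
  congr 1
  rw [lmarginal, ← lintegral_indicator_one (hA.inter hS.meas),
    lintegral_map (measurable_one.indicator (hA.inter hS.meas)) measurable_updateFinset]

open Classical in
theorem lintegral_uniformMeasure_coordSlice {S : Set (ι → ℝ)} (hS : IsDownSet S) (J : Set ι)
    (x : ι → ℝ) {F : Finset ι} (hF : freeCoords S J x = F) {f : (ι → ℝ) → ℝ≥0∞}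
    (hf : Measurable f) :
    ∫⁻ y, f y ∂uniformMeasure (coordSlice S J x) =
      (lmarginal (fun _ : ι => (volume : Measure ℝ)) F (S.indicator 1) (zeroOn J x))⁻¹ *
        lmarginal (fun _ : ι => (volume : Measure ℝ)) F (S.indicator f) (zeroOn J x) := by
  rw [uniformMeasure_coordSlice_eq_smul hS J x hF, lintegral_smul_measure,
    ← lintegral_indicator hS.meas, lintegral_map (hf.indicator hS.meas) measurable_updateFinset]
  rfl

theorem ae_mem_coordSlice {S : Set (ι → ℝ)} (hS : IsDownSet S) (J : Set ι) (x : ι → ℝ) :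
    ∀ᵐ y ∂uniformMeasure (coordSlice S J x), y ∈ coordSlice S J x :=
  ae_cond_mem (measurableSet_coordSlice hS J x)

theorem uniformMeasure_univ_le_one {S : Set (ι → ℝ)} (hS : IsDownSet S) (J : Set ι) (x : ι → ℝ) :
    uniformMeasure (coordSlice S J x) Set.univ ≤ 1 := by
  classical
  rw [uniformMeasure_coordSlice_apply hS J x _ rfl, Set.inter_univ]
  exact ENNReal.inv_mul_le_one _

/-- Almost every point of the slice has no vanishing free coordinate. -/
theorem ae_freeCoords_ne_zero {S : Set (ι → ℝ)} (hS : IsDownSet S) (J : Set ι) (x : ι → ℝ) :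
    ∀ᵐ y ∂uniformMeasure (coordSlice S J x), ∀ j ∈ freeCoords S J x, y j ≠ 0 := by
  classical
  rw [ae_all_iff]
  intro j
  by_cases hj : j ∈ freeCoords S J x
  swap
  · simp [hj]
  simp only [hj, forall_const]
  change uniformMeasure (coordSlice S J x) {y | ¬ (y j ≠ 0)} = 0
  simp only [ne_eq, not_not]
  rw [uniformMeasure_coordSlice_apply hS J x _ rfl]
  refine mul_eq_zero_of_right _ (measure_mono_null (t := {u | u ⟨j, hj⟩ = 0}) ?_ ?_)
  · intro u hu
    have := hu.2
    simpa [glue, hj] using this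
  · exact Measure.pi_hyperplane _ _ _

/-- Uniform distributions on slices form a consistent system of conditional distributions. -/
theorem bind_uniformMeasure_coordSlice {S : Set (ι → ℝ)} (hS : IsDownSet S)
    (hfin : ∀ (J : Set ι) (F : Finset ι) (x : ι → ℝ), volume (glue (F : Set ι) J x ⁻¹' S) ≠ ∞)
    {J' J : Set ι} (hJ : J' ⊆ J) (x : ι → ℝ) :
    (uniformMeasure (coordSlice S J x)).bind (fun y => uniformMeasure (coordSlice S J' y)) =
      uniformMeasure (coordSlice S J x) := by
  classical
  ext A hA
  rw [Measure.bind_apply hA (measurable_uniformMeasure_coordSlice hS J').aemeasurable]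
  set F := freeFinset S J x with hFdef
  have hF : freeCoords S J x = F := (coe_freeFinset S J x).symm
  set F' := F.filter (· ∈ J') with hF'def
  have hF' : (F' : Set ι) = freeCoords S J x ∩ J' := by
    rw [hF]; ext j; simp [hF'def]
  let L := lmarginal (fun _ : ι => (volume : Measure ℝ))
  have hind : ∀ (B : Set (ι → ℝ)), MeasurableSet B →
      Measurable (B.indicator (1 : (ι → ℝ) → ℝ≥0∞)) := fun B hB => measurable_one.indicator hB
  have hLm : ∀ (B : Set (ι → ℝ)), MeasurableSet B → Measurable (L F' (B.indicator 1)) :=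
    fun B hB => (hind B hB).lmarginal _
  set g : (ι → ℝ) → ℝ≥0∞ := fun y => (L F' (S.indicator 1) y)⁻¹ * L F' ((S ∩ A).indicator 1) y
    with hg
  have hgm : Measurable g := (hLm S hS.meas).inv.mul (hLm _ (hS.meas.inter hA))
  have hzero : ∀ y ∈ coordSlice S J x, ∀ j ∈ J, j ∉ F → y j = 0 := by
    intro y hy j hj hjF
    by_contra h
    exact hjF (by rw [← Finset.mem_coe, ← hF]; exact ⟨hj, y, hy, h⟩)
  -- Almost surely the free set at `y` within `J'` is `F'`, so the inner kernel is given by the one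
  -- formula `g`.
  have hae : ∀ᵐ y ∂uniformMeasure (coordSlice S J x),
      uniformMeasure (coordSlice S J' y) A = g y := by
    filter_upwards [ae_mem_coordSlice hS J x, ae_freeCoords_ne_zero hS J x] with y hy h0
    rw [uniformMeasure_coordSlice_eq_lmarginal hS J' y (F := F')
      (by rw [hF', freeCoords_of_ne_zero hJ hy h0]) hA]
    have hc : ∀ j ∉ F', zeroOn J' y j = y j := by
      intro j hj
      by_cases h' : j ∈ J'
      · have : j ∉ F := fun h => hj (by simp [hF'def, h, h'])
        simp [zeroOn, h', hzero y hy j (hJ h') this]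
      · simp [zeroOn, h']
    rw [lmarginal_congr _ _ hc, lmarginal_congr _ _ hc]
  rw [lintegral_congr_ae hae, lintegral_uniformMeasure_coordSlice hS J x hF hgm,
    uniformMeasure_coordSlice_eq_lmarginal hS J x hF hA]
  congr 1
  -- Fubini over `F \ F'` and `F'`: the inner integral of the indicator of `S` cancels the
  -- normalisation contained in `g`.
  have hsplit : F = (F \ F') ∪ F' := (Finset.sdiff_union_of_subset (Finset.filter_subset _ _)).symm
  have hdisj : Disjoint (F \ F') F' := Finset.sdiff_disjoint
  rw [hsplit, lmarginal_union _ _ (hgm.indicator hS.meas) hdisj,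
    lmarginal_union _ _ (hind _ (hS.meas.inter hA)) hdisj]
  rw [lmarginal, lmarginal]
  refine lintegral_congr fun u => ?_
  set y := Function.updateFinset (zeroOn J x) (F \ F') u with hy
  have h1 : S.indicator g = fun y => S.indicator (1 : (ι → ℝ) → ℝ≥0∞) y * g y := by
    ext z; by_cases h : z ∈ S <;> simp [h]
  have hgc : ∀ x y : ι → ℝ, (∀ j ∉ F', x j = y j) → g x = g y := by
    intro a b hab
    simp only [hg, L]
    rw [lmarginal_congr _ _ hab, lmarginal_congr _ _ hab]
  rw [h1, lmarginal_mul_of_indep (hind S hS.meas) hgc, hg]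
  change L F' (S.indicator 1) y * ((L F' (S.indicator 1) y)⁻¹ * L F' ((S ∩ A).indicator 1) y) =
    L F' ((S ∩ A).indicator 1) y
  -- If the inner volume vanishes, so does the smaller numerator, and both sides are zero.
  by_cases hV : L F' (S.indicator 1) y = 0
  · have : L F' ((S ∩ A).indicator 1) y ≤ L F' (S.indicator 1) y :=
      lmarginal_mono (fun z => Set.indicator_le_indicator_of_subset Set.inter_subset_left
        (fun _ => zero_le) z) y
    rw [hV] at this
    simp [le_antisymm this (zero_le)]
  · have hV' : L F' (S.indicator 1) y ≠ ∞ := by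
      have h2 := hfin (F' : Set ι) F' y
      rw [volume_glue_preimage y hS.meas, lmarginal_congr _ (y := y) _
        (fun j hj => by simp [zeroOn, hj])] at h2
      exact h2
    rw [← mul_assoc, ENNReal.mul_inv_cancel hV hV', one_mul]

end DownSet

/-- If the slices through `x` and `x'`, which differ at `i ∉ J` only, are related by the constraint
`T`, then so are the uniform distributions on them. -/
theorem restrict_uniformMeasure_coordSlice {ι : Type} [Fintype ι] [DecidableEq ι]
    {S : Set (ι → ℝ)} (hS : IsDownSet S)
    {J : Set ι} {i : ι} (hi : i ∉ J) {x x' : ι → ℝ} (hx : ∀ j ≠ i, x j = x' j)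
    (hF : freeCoords S J x = freeCoords S J x') {T : Set (ι → ℝ)}
    (hST : ∀ y, (∀ j ∉ J, y j = x j) → (Function.update y i (x' i) ∈ S ↔ y ∈ S ∧ y ∈ T))
    (hone : uniformMeasure (coordSlice S J x') Set.univ = 1) :
    (uniformMeasure (coordSlice S J x)).restrict T =
      uniformMeasure (coordSlice S J x) T •
        (uniformMeasure (coordSlice S J x')).map (fun y => Function.update y i (x i)) := by
  classical
  have hmeas : Measurable (fun y : ι → ℝ => Function.update y i (x i)) := measurable_update_left
  ext A hA
  set F := freeCoords S J x with hFdef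
  have hiF : i ∉ F := fun h => hi (freeCoords_subset _ _ _ h)
  have hglue : ∀ u : F → ℝ, glue F J x' u = Function.update (glue F J x u) i (x' i) := by
    intro u
    funext j
    by_cases hji : j = i
    · subst hji
      simp [glue, hiF, hi]
    · simp [glue, hji, hx j hji]
  have hself : ∀ u : F → ℝ, glue F J x u i = x i := fun u => by simp [glue, hiF, hi]
  have houtside : ∀ u : F → ℝ, ∀ j ∉ J, glue F J x u j = x j := fun u j hj => by
    have : j ∉ F := fun h => hj (freeCoords_subset _ _ _ h)
    simp [glue, hj, this]
  -- In the common free parameters, the slice through `x'` is the part of the slice through `x`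
  -- lying in `T`. The rest compares normalising volumes.
  have hpre : ∀ B : Set (ι → ℝ), glue F J x' ⁻¹'
      (S ∩ (fun y => Function.update y i (x i)) ⁻¹' B) = glue F J x ⁻¹' (S ∩ (T ∩ B)) := by
    intro B
    ext u
    have h1 : Function.update (glue F J x u) i (x i) = glue F J x u := by
      rw [← hself u, Function.update_eq_self]
    simp only [Set.mem_preimage, Set.mem_inter_iff, hglue, Function.update_idem, h1,
      hST _ (houtside u), and_assoc]
  have hV' := hpre Set.univ
  rw [Set.preimage_univ, Set.inter_univ, Set.inter_univ] at hV'
  rw [uniformMeasure_coordSlice_apply hS J x' F hF.symm, Set.inter_univ, hV'] at hone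
  rw [Measure.restrict_apply hA, Measure.smul_apply, smul_eq_mul, Measure.map_apply hmeas hA,
    uniformMeasure_coordSlice_apply hS J x F rfl, uniformMeasure_coordSlice_apply hS J x F rfl,
    uniformMeasure_coordSlice_apply hS J x' F hF.symm, hpre, hV', mul_assoc, ← mul_assoc _ _
      (volume (glue F J x ⁻¹' (S ∩ (T ∩ A)))), mul_comm (volume (glue F J x ⁻¹' (S ∩ T))), hone,
    one_mul, Set.inter_comm A T]

/-! ### Polytopes with pair constraints and their Gibbs kernels -/

/-- A system of constraints `0 ≤ x i ≤ b i` and `a i * x i + a j * x j ≤ r i j` for adjacent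
`i, j`. -/
structure PairConstraints (ι : Type) where
  graph : SimpleGraph ι
  a : ι → ℝ
  b : ι → ℝ
  r : ι → ι → ℝ
  a_pos : ∀ i, 0 < a i
  b_pos : ∀ i, 0 < b i
  r_pos : ∀ i j, graph.Adj i j → 0 < r i j
  r_symm : ∀ i j, r i j = r j i

namespace PairConstraints

variable {ι : Type} (C : PairConstraints ι)

/-- The polytope of solutions of the constraints. -/
def body : Set (ι → ℝ) :=
  {x | (∀ i, 0 ≤ x i ∧ x i ≤ C.b i) ∧
    ∀ i j, C.graph.Adj i j → C.a i * x i + C.a j * x j ≤ C.r i j}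

variable {C}

theorem mem_body_of_le {x y : ι → ℝ} (hy : y ∈ C.body) (h0 : ∀ j, 0 ≤ x j)
    (h : ∀ j, x j ≤ y j) : x ∈ C.body := by
  refine ⟨fun j => ⟨h0 j, (h j).trans (hy.1 j).2⟩, fun j l hjl => le_trans ?_ (hy.2 j l hjl)⟩
  have := (C.a_pos j).le
  have := (C.a_pos l).le
  have := h j
  have := h l
  gcongr

variable (C) in
theorem isClosed_body : IsClosed C.body := by
  have : C.body = (⋂ i, {x | 0 ≤ x i ∧ x i ≤ C.b i}) ∩
      ⋂ i, ⋂ j, ⋂ _ : C.graph.Adj i j, {x | C.a i * x i + C.a j * x j ≤ C.r i j} := by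
    ext x; simp [body]
  rw [this]
  refine (isClosed_iInter fun i => ?_).inter
    (isClosed_iInter fun i => isClosed_iInter fun j => isClosed_iInter fun _ => ?_)
  · exact (isClosed_le continuous_const (continuous_apply i)).inter
      (isClosed_le (continuous_apply i) continuous_const)
  · exact isClosed_le (by fun_prop) continuous_const

variable (C) in
theorem volume_glue_ne_top (F J : Set ι) {_ : Fintype F} (x : ι → ℝ) :
    volume (glue F J x ⁻¹' C.body) ≠ ∞ := by
  refine ne_top_of_le_ne_top (measure_Icc_lt_top (a := 0) (b := fun j : F => C.b j)).ne
    (measure_mono fun u hu => ?_)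
  have h : ∀ j : F, 0 ≤ u j ∧ u j ≤ C.b j := fun j => by
    have := hu.1 j
    simpa [glue] using this
  exact ⟨fun j => (h j).1, fun j => (h j).2⟩

/-- A section in one coordinate direction is compact, contains `0` and is closed under decreasing
the coordinate. -/
theorem exists_update_mem_body_iff [DecidableEq ι] {y : ι → ℝ} (hy : y ∈ C.body) (m : ι) :
    ∃ M, 0 ≤ M ∧ ∀ t, Function.update y m t ∈ C.body ↔ 0 ≤ t ∧ t ≤ M := by
  set D := {t : ℝ | Function.update y m t ∈ C.body}
  have hcl : IsClosed D := C.isClosed_body.preimage (continuous_const.update m continuous_id)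
  have h0 : (0 : ℝ) ∈ D := mem_body_of_le hy (fun j => by
      by_cases h : j = m
      · subst h; simp
      · simpa [h] using (hy.1 j).1) fun j => by
      by_cases h : j = m
      · subst h; simpa using (hy.1 j).1
      · simp [h]
  have hbd : ∀ t ∈ D, 0 ≤ t ∧ t ≤ C.b m := fun t ht => by
    have := ht.1 m
    simpa using this
  have hba : BddAbove D := ⟨C.b m, fun t ht => (hbd t ht).2⟩
  refine ⟨sSup D, le_csSup hba h0, fun t => ⟨fun ht => ⟨(hbd t ht).1, le_csSup hba ht⟩, ?_⟩⟩
  rintro ⟨h1, h2⟩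
  refine mem_body_of_le (hcl.csSup_mem ⟨0, h0⟩ hba) (fun j => ?_) fun j => ?_
  · by_cases h : j = m
    · subst h; simpa using h1
    · simpa [h] using (hy.1 j).1
  · by_cases h : j = m
    · subst h; simpa using h2
    · simp [h]

variable [Fintype ι]

variable (C) in
theorem isDownSet_body : IsDownSet C.body :=
  ⟨C.isClosed_body.measurableSet, fun _ hy j => (hy.1 j).1, fun _ hy _ h0 h =>
    mem_body_of_le hy h0 h⟩

/-- Each free coordinate has a witness in the slice where it is positive. Keeping every free
coordinate below half its witness value leaves an open box in the polytope: a constraint between two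
free coordinates is the average of the constraints at their two witnesses. -/
theorem volume_glue_ne_zero {J : Set ι} {x : ι → ℝ} (hx : x ∈ C.body) {F : Set ι}
    {_ : Fintype F} (hF : freeCoords C.body J x = F) : volume (glue F J x ⁻¹' C.body) ≠ 0 := by
  have hex : ∀ j : F, ∃ y ∈ coordSlice C.body J x, y j ≠ 0 := fun j =>
    (hF.symm ▸ j.2 : (j : ι) ∈ freeCoords C.body J x).2
  choose y hy hne using hex
  have hpos : ∀ j : F, 0 < y j j := fun j => lt_of_le_of_ne ((hy j).1.1 j).1 (hne j).symm
  have hopen : IsOpen {u : F → ℝ | ∀ j, 0 < u j ∧ u j < y j j / 2} := by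
    simp only [Set.ofPred_forall]
    refine isOpen_iInter_of_finite fun j => ?_
    exact (isOpen_lt continuous_const (continuous_apply j)).inter
      (isOpen_lt (continuous_apply j) continuous_const)
  have hnon : {u : F → ℝ | ∀ j, 0 < u j ∧ u j < y j j / 2}.Nonempty :=
    ⟨fun j => y j j / 4, fun j => by have := hpos j; constructor <;> linarith⟩
  refine ((hopen.measure_pos volume hnon).trans_le (measure_mono fun u hu => ?_)).ne'
  have hin : ∀ (j : ι) (h : j ∈ F), glue F J x u j = u ⟨j, h⟩ := fun j h => by simp [glue, h]
  have hout : ∀ j ∉ F, ∀ z ∈ coordSlice C.body J x, glue F J x u j ≤ z j := by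
    intro j hj z hz
    by_cases hJ : j ∈ J
    · simpa [glue, hj, hJ] using (hz.1.1 j).1
    · simp [glue, hj, hJ, hz.2 j hJ]
  have hxs : x ∈ coordSlice C.body J x := ⟨hx, fun _ _ => rfl⟩
  have h0 : ∀ j, 0 ≤ glue F J x u j := by
    intro j
    by_cases h : j ∈ F
    · rw [hin j h]; exact (hu _).1.le
    · by_cases hJ : j ∈ J
      · simp [glue, h, hJ]
      · simpa [glue, h, hJ] using (hx.1 j).1
  refine ⟨fun j => ⟨h0 j, ?_⟩, fun j l hjl => ?_⟩
  · by_cases h : j ∈ F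
    · rw [hin j h]
      have := (hu ⟨j, h⟩).2
      have := hpos ⟨j, h⟩
      have := ((hy ⟨j, h⟩).1.1 j).2
      simp only at *
      linarith
    · exact (hout j h x hxs).trans (hx.1 j).2
  · have hself : ∀ (j : ι) (h : j ∈ F), C.a j * glue F J x u j ≤ C.a j * (y ⟨j, h⟩ j / 2) :=
      fun j h => by
        rw [hin j h]
        exact mul_le_mul_of_nonneg_left (hu ⟨j, h⟩).2.le (C.a_pos j).le
    have hprod : ∀ (z : ι → ℝ) (p : ι), z ∈ C.body → 0 ≤ C.a p * z p :=
      fun z p hz => mul_nonneg (C.a_pos p).le (hz.1 p).1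
    by_cases h : j ∈ F <;> by_cases h' : l ∈ F
    · have h1 := hself j h
      have h2 := hself l h'
      have h3 := (hy ⟨j, h⟩).1.2 j l hjl
      have h4 := (hy ⟨l, h'⟩).1.2 j l hjl
      have h5 := hprod _ l (hy ⟨j, h⟩).1
      have h6 := hprod _ j (hy ⟨l, h'⟩).1
      linarith
    · have h1 := hself j h
      have h2 := mul_le_mul_of_nonneg_left (hout l h' _ (hy ⟨j, h⟩)) (C.a_pos l).le
      have h3 := (hy ⟨j, h⟩).1.2 j l hjl
      have h4 := hprod _ j (hy ⟨j, h⟩).1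
      linarith
    · have h1 := hself l h'
      have h2 := mul_le_mul_of_nonneg_left (hout j h _ (hy ⟨l, h'⟩)) (C.a_pos j).le
      have h3 := (hy ⟨l, h'⟩).1.2 j l hjl
      have h4 := hprod _ l (hy ⟨l, h'⟩).1
      linarith
    · have h1 := mul_le_mul_of_nonneg_left (hout j h x hxs) (C.a_pos j).le
      have h2 := mul_le_mul_of_nonneg_left (hout l h' x hxs) (C.a_pos l).le
      have h3 := hx.2 j l hjl
      linarith

variable (C) in
/-- The Gibbs kernel resampling the coordinates in `J`. -/
noncomputable abbrev gibbs (J : Set ι) (x : ι → ℝ) : Measure (ι → ℝ) :=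
  uniformMeasure (coordSlice C.body J x)

theorem gibbs_univ {J : Set ι} {x : ι → ℝ} (hx : x ∈ C.body) : C.gibbs J x Set.univ = 1 := by
  classical
  rw [gibbs, uniformMeasure_coordSlice_apply C.isDownSet_body J x _ rfl, Set.inter_univ]
  exact ENNReal.inv_mul_cancel (volume_glue_ne_zero hx rfl) (C.volume_glue_ne_top _ _ _)

theorem isProbabilityMeasure_gibbs {J : Set ι} {x : ι → ℝ} (hx : x ∈ C.body) :
    IsProbabilityMeasure (C.gibbs J x) := ⟨gibbs_univ hx⟩

theorem ae_gibbs {J : Set ι} {x : ι → ℝ} : ∀ᵐ y ∂C.gibbs J x, y ∈ coordSlice C.body J x :=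
  ae_mem_coordSlice C.isDownSet_body J x

theorem measurable_gibbs (J : Set ι) : Measurable (C.gibbs J) :=
  measurable_uniformMeasure_coordSlice C.isDownSet_body J

theorem bind_gibbs {J' J : Set ι} (hJ : J' ⊆ J) (x : ι → ℝ) :
    (C.gibbs J x).bind (C.gibbs J') = C.gibbs J x :=
  bind_uniformMeasure_coordSlice C.isDownSet_body (fun J F x => C.volume_glue_ne_top F J x) hJ x

theorem measurable_lintegral_gibbs (J : Set ι) {f : (ι → ℝ) → ℝ≥0∞} (hf : Measurable f) :
    Measurable fun x => ∫⁻ y, f y ∂C.gibbs J x :=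
  (Measure.measurable_lintegral hf).comp (measurable_gibbs J)

theorem lintegral_lintegral_gibbs {J' J : Set ι} (hJ : J' ⊆ J) (x : ι → ℝ) {f : (ι → ℝ) → ℝ≥0∞}
    (hf : Measurable f) :
    ∫⁻ y, ∫⁻ z, f z ∂C.gibbs J' y ∂C.gibbs J x = ∫⁻ z, f z ∂C.gibbs J x := by
  conv_rhs => rw [← bind_gibbs hJ x]
  rw [Measure.lintegral_bind (measurable_gibbs J').aemeasurable hf.aemeasurable]

theorem lintegral_gibbs_congr {J : Set ι} {x y : ι → ℝ} (h : ∀ j ∉ J, x j = y j)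
    (f : (ι → ℝ) → ℝ≥0∞) : ∫⁻ z, f z ∂C.gibbs J x = ∫⁻ z, f z ∂C.gibbs J y := by
  rw [gibbs, gibbs, coordSlice_congr _ h]

theorem lintegral_gibbs_of_forall_mem {J : Set ι} {x : ι → ℝ} (hx : x ∈ C.body)
    {f : (ι → ℝ) → ℝ≥0∞} {c : ℝ≥0∞} (h : ∀ y ∈ coordSlice C.body J x, f y = c) :
    ∫⁻ y, f y ∂C.gibbs J x = c := by
  rw [lintegral_congr_ae (g := fun _ => c) (ae_gibbs.mono fun y hy => h y hy), lintegral_const,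
    gibbs_univ hx, mul_one]

/-- Under a single-site kernel, the coordinate is uniformly distributed on an interval `[0, M]`. -/
theorem lintegral_gibbs_singleton_le {y : ι → ℝ} (hy : y ∈ C.body) (m : ι) {B : ℝ}
    (hB : ∀ z ∈ C.body, z m ≤ B) {g : ℝ → ℝ≥0∞} (hg : Measurable g) {c : ℝ≥0∞} (h0 : g 0 ≤ c)
    (h : ∀ M, 0 < M → M ≤ B → ∫⁻ t in Set.Icc 0 M, g t ≤ c * ENNReal.ofReal M) :
    ∫⁻ z, g (z m) ∂C.gibbs {m} y ≤ c := by
  classical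
  obtain ⟨M, hM0, hM⟩ := exists_update_mem_body_iff hy m
  have hslice : ∀ z ∈ coordSlice C.body {m} y, z = Function.update y m (z m) := fun z hz => by
    funext j
    by_cases hj : j = m
    · subst hj; simp
    · simp [hj, hz.2 j hj]
  -- For `M = 0` the coordinate is forced to vanish, which is why `g 0` needs a bound of its own.
  rcases hM0.eq_or_lt with hMz | hMpos
  · rw [lintegral_gibbs_of_forall_mem hy (c := g 0)]
    · exact h0
    · intro z hz
      have h1 := (hM (z m)).1 (hslice z hz ▸ hz.1)
      rw [show z m = 0 by linarith]
  · have hF : freeCoords C.body {m} y = ((({m} : Finset ι)) : Set ι) := by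
      ext j
      rw [Finset.coe_singleton]
      refine ⟨fun hj => hj.1, fun hj => ⟨hj, Function.update y m M,
        ⟨(hM M).2 ⟨hM0, le_rfl⟩, fun l hl => ?_⟩, ?_⟩⟩
      · have : l ≠ m := hl
        simp [this]
      · rw [Set.mem_singleton_iff] at hj
        subst hj
        simpa using hMpos.ne'
    have hup : ∀ t, Function.update (zeroOn {m} y) m t = Function.update y m t := by
      intro t
      funext j
      by_cases hj : j = m
      · subst hj; simp
      · simp [hj, zeroOn]
    have hB' : M ≤ B := by simpa using hB _ ((hM M).2 ⟨hM0, le_rfl⟩)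
    have hint : ∀ f : ℝ → ℝ≥0∞, ∫⁻ t, C.body.indicator (fun z => f (z m))
        (Function.update (zeroOn {m} y) m t) = ∫⁻ t in Set.Icc 0 M, f t := by
      intro f
      rw [← lintegral_indicator measurableSet_Icc]
      refine lintegral_congr fun t => ?_
      rw [hup]
      by_cases ht : Function.update y m t ∈ C.body
      · rw [Set.indicator_of_mem ht, Set.indicator_of_mem (Set.mem_Icc.2 ((hM t).1 ht))]
        simp
      · rw [Set.indicator_of_notMem ht,
          Set.indicator_of_notMem (fun h => ht ((hM t).2 (Set.mem_Icc.1 h)))]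
    have key := lintegral_uniformMeasure_coordSlice C.isDownSet_body {m} y hF
      (f := fun z => g (z m)) (hg.comp (measurable_pi_apply m))
    have hden := hint (fun _ => 1)
    have hone : (fun z : ι → ℝ => (1 : ℝ≥0∞)) = 1 := rfl
    rw [hone] at hden
    rw [lmarginal_singleton, lmarginal_singleton] at key
    simp only at key
    rw [hden, hint g] at key
    rw [gibbs, key, setLIntegral_const, one_mul, Real.volume_Icc, sub_zero]
    calc _ ≤ (ENNReal.ofReal M)⁻¹ * (c * ENNReal.ofReal M) := by gcongr; exact h M hMpos hB'
      _ = c := by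
        rw [mul_comm c, ← mul_assoc, ENNReal.inv_mul_cancel _ ENNReal.ofReal_ne_top, one_mul]
        simpa using hMpos

/-- By consistency, resampling `J` may be followed by resampling `m` alone, so a bound valid for all
uniform laws on intervals `[0, M]` passes to the marginal at `m`. -/
theorem lintegral_gibbs_coord_le {x : ι → ℝ} (hx : x ∈ C.body) {J : Set ι} {m : ι} (hm : m ∈ J)
    {B : ℝ} (hB : ∀ z ∈ C.body, z m ≤ B) {g : ℝ → ℝ≥0∞} (hg : Measurable g) {c : ℝ≥0∞}
    (h0 : g 0 ≤ c) (h : ∀ M, 0 < M → M ≤ B → ∫⁻ t in Set.Icc 0 M, g t ≤ c * ENNReal.ofReal M) :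
    ∫⁻ z, g (z m) ∂C.gibbs J x ≤ c := by
  rw [← lintegral_lintegral_gibbs (Set.singleton_subset_iff.2 hm) x
    (f := fun z => g (z m)) (hg.comp (measurable_pi_apply m))]
  calc _ ≤ ∫⁻ _, c ∂C.gibbs J x := lintegral_mono_ae (ae_gibbs.mono fun y hy =>
        lintegral_gibbs_singleton_le hy.1 m hB hg h0 h)
    _ = c := by rw [lintegral_const, gibbs_univ hx, mul_one]

/-- A uniform variable on an interval `[0, M']` with `M' ≤ R` has mean at most `R / 2`. This is the
origin of the factor `1/2` in `spread`. -/
theorem lintegral_gibbs_mul_le {x : ι → ℝ} (hx : x ∈ C.body) {J : Set ι} {m : ι} (hm : m ∈ J)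
    {R : ℝ} (hR : ∀ z ∈ C.body, C.a m * z m ≤ R) :
    ∫⁻ z, ENNReal.ofReal (C.a m * z m) ∂C.gibbs J x ≤ ENNReal.ofReal (R / 2) := by
  have ha := C.a_pos m
  refine lintegral_gibbs_coord_le hx hm (B := R / C.a m)
    (fun z hz => by rw [le_div_iff₀ ha]; linarith [hR z hz])
    (g := fun t => ENNReal.ofReal (C.a m * t)) (by fun_prop) (by simp) fun M hM0 hMR => ?_
  rw [le_div_iff₀ ha] at hMR
  rw [← ofReal_integral_eq_lintegral_ofReal
      ((by fun_prop : Continuous fun t : ℝ => C.a m * t).integrableOn_Icc)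
      ((ae_restrict_mem measurableSet_Icc).mono fun t ht => mul_nonneg ha.le ht.1),
    ← ENNReal.ofReal_mul (by nlinarith), integral_const_mul, integral_Icc_eq_integral_Ioc,
    ← intervalIntegral.integral_of_le hM0.le, integral_id]
  refine ENNReal.ofReal_le_ofReal ?_
  nlinarith

/-- For `0 ≤ s ≤ R` the uniform law on `[0, M]` gives the positive part of `(a M - R + s) / (a M)`.
This is nondecreasing in `M` and equals `s / R` at the extreme value `a M = R`. -/
theorem gibbs_tail_le {x : ι → ℝ} (hx : x ∈ C.body) {J : Set ι} {m : ι} (hm : m ∈ J)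
    {R s : ℝ} (hR : ∀ z ∈ C.body, C.a m * z m ≤ R) (hs : s ≤ R) (h0 : 0 < R) :
    C.gibbs J x {z | R - s < C.a m * z m} ≤ ENNReal.ofReal (s / R) := by
  have ha := C.a_pos m
  set θ := (R - s) / C.a m with hθ
  have hset : {z : ι → ℝ | R - s < C.a m * z m} = (fun z => z m) ⁻¹' Set.Ioi θ := by
    ext z
    simp only [Set.mem_ofPred_eq, Set.mem_preimage, Set.mem_Ioi, hθ, div_lt_iff₀ ha, mul_comm]
  have hms : MeasurableSet ((fun z : ι → ℝ => z m) ⁻¹' Set.Ioi θ) :=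
    measurableSet_Ioi.preimage (measurable_pi_apply m)
  rw [hset, ← lintegral_indicator_one hms]
  have hθ0 : 0 ≤ θ := div_nonneg (by linarith) ha.le
  refine lintegral_gibbs_coord_le hx hm (B := R / C.a m)
    (fun z hz => by rw [le_div_iff₀ ha]; linarith [hR z hz])
    (g := (Set.Ioi θ).indicator 1) (measurable_one.indicator measurableSet_Ioi)
    (by simp [hθ0]) fun M hM0 hMR => ?_
  rw [le_div_iff₀ ha] at hMR
  rw [lintegral_indicator_one measurableSet_Ioi, Measure.restrict_apply measurableSet_Ioi]
  have hsub : Set.Ioi θ ∩ Set.Icc 0 M ⊆ Set.Icc θ M := fun t ht => ⟨le_of_lt ht.1, ht.2.2⟩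
  refine (measure_mono hsub).trans ?_
  rw [Real.volume_Icc]
  by_cases hs0 : s < 0
  · rw [ENNReal.ofReal_of_nonpos]
    · exact zero_le
    · have : R ≤ R - s := by linarith
      rw [hθ, sub_nonpos, le_div_iff₀ ha]
      linarith
  rw [not_lt] at hs0
  rw [← ENNReal.ofReal_mul (by positivity)]
  refine ENNReal.ofReal_le_ofReal ?_
  have h1 : M - θ = (C.a m * M - (R - s)) / C.a m := by rw [hθ]; field_simp
  rw [h1, div_mul_eq_mul_div, div_le_div_iff₀ ha h0]
  nlinarith [mul_nonneg (sub_nonneg.2 hs) (sub_nonneg.2 hMR)]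

end PairConstraints

/-! ### Comparison of integrals up to an additive error -/

/-- The two extended nonnegative numbers `u`, `v` are at distance at most `d`. -/
def Within (d u v : ℝ≥0∞) : Prop := u ≤ v + d ∧ v ≤ u + d

theorem Within.symm {d u v : ℝ≥0∞} (h : Within d u v) : Within d v u := ⟨h.2, h.1⟩

theorem Within.trans {d d' u v w : ℝ≥0∞} (h : Within d u v) (h' : Within d' v w) :
    Within (d + d') u w :=
  ⟨h.1.trans ((add_le_add_left h'.1 d).trans_eq (by ring)),
    h'.2.trans ((add_le_add_left h.2 d').trans_eq (by ring))⟩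

theorem Within.mono {d d' u v : ℝ≥0∞} (h : Within d u v) (hd : d ≤ d') : Within d' u v :=
  ⟨h.1.trans (by gcongr), h.2.trans (by gcongr)⟩

theorem within_lintegral {α : Type*} [MeasurableSpace α] {μ : Measure α} (hμ : μ Set.univ = 1)
    {f g : α → ℝ≥0∞} {d : ℝ≥0∞} (h : ∀ᵐ y ∂μ, Within d (f y) (g y)) :
    Within d (∫⁻ y, f y ∂μ) (∫⁻ y, g y ∂μ) := by
  have key : ∀ {f g : α → ℝ≥0∞}, (∀ᵐ y ∂μ, f y ≤ g y + d) → ∫⁻ y, f y ∂μ ≤ ∫⁻ y, g y ∂μ + d := by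
    intro f g h
    refine (lintegral_mono_ae h).trans ?_
    rw [lintegral_add_right _ measurable_const, lintegral_const, hμ, mul_one]
  exact ⟨key (h.mono fun _ h => h.1), key (h.mono fun _ h => h.2)⟩

/-! ### The effect of one boundary coordinate on the resampling of a block -/

namespace PairConstraints

variable {ι : Type} {C : PairConstraints ι}

section Update

variable [DecidableEq ι]

/-- Outside `J` the updated point agrees with `x'`, so only the constraints between `i` and `J`
remain to be checked. -/
theorem update_mem_body_of_agree {J : Set ι} {i : ι} {x x' y : ι → ℝ}
    (hx' : x' ∈ C.body) (hxx : ∀ j ≠ i, x j = x' j) (hy : y ∈ C.body) (hyx : ∀ j ∉ J, y j = x j)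
    (h : ∀ j ∈ J, C.graph.Adj i j → C.a i * x' i + C.a j * y j ≤ C.r i j) :
    Function.update y i (x' i) ∈ C.body := by
  have key : ∀ j, C.graph.Adj i j →
      C.a i * x' i + C.a j * Function.update y i (x' i) j ≤ C.r i j := by
    intro j hij
    rw [Function.update_of_ne hij.ne']
    by_cases hj : j ∈ J
    · exact h j hj hij
    · rw [hyx j hj, hxx j hij.ne']
      exact hx'.2 i j hij
  refine ⟨fun j => ?_, fun p q hpq => ?_⟩
  · by_cases hj : j = i
    · subst hj; simpa using hx'.1 j
    · simpa [hj] using hy.1 j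
  · by_cases hp : p = i
    · subst hp
      simpa using key q hpq
    · by_cases hq : q = i
      · subst hq
        have := key p hpq.symm
        rw [C.r_symm] at this
        simpa [add_comm] using this
      · simpa [hp, hq] using hy.2 p q hpq

theorem update_mem_body_of_le {y : ι → ℝ} (hy : y ∈ C.body) {m : ι} {t : ℝ} (h0 : 0 ≤ t)
    (ht : t ≤ y m) : Function.update y m t ∈ C.body := by
  refine mem_body_of_le hy (fun j => ?_) fun j => ?_ <;> by_cases h : j = m
  · subst h; simpa using h0
  · simpa [h] using (hy.1 j).1
  · subst h; simpa using ht
  · simp [h]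

theorem update_mem_coordSlice {J : Set ι} {i : ι} {x x' y : ι → ℝ} (hxx : ∀ j ≠ i, x j = x' j)
    (hyx : y ∈ coordSlice C.body J x) (hmem : Function.update y i (x' i) ∈ C.body) :
    Function.update y i (x' i) ∈ coordSlice C.body J x' :=
  ⟨hmem, fun j hj => by
    by_cases h : j = i
    · subst h; simp
    · simp [h, hyx.2 j hj, hxx j h]⟩

end Update

theorem mul_le_of_adj {x : ι → ℝ} (hx : x ∈ C.body) {i m : ι} (him : C.graph.Adj i m) :
    C.a i * x i ≤ C.r i m := by
  have h1 := hx.2 i m him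
  have h2 := mul_nonneg (C.a_pos m).le (hx.1 m).1
  linarith

variable [Fintype ι] [DecidableEq ι]

/-- The Gibbs kernel of `J` is not affected by coordinates which are not adjacent to `J`. -/
theorem gibbs_eq_map_of_not_adj {J : Set ι} {i : ι} (hi : i ∉ J)
    (hJ : ∀ j ∈ J, ¬ C.graph.Adj i j) {x x' : ι → ℝ} (hx : x ∈ C.body) (hx' : x' ∈ C.body)
    (hxx : ∀ j ≠ i, x j = x' j) :
    C.gibbs J x = (C.gibbs J x').map (fun y => Function.update y i (x i)) := by
  have hxx' : ∀ j ≠ i, x' j = x j := fun j hj => (hxx j hj).symm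
  have hsub : ∀ {x x' : ι → ℝ}, x' ∈ C.body → (∀ j ≠ i, x j = x' j) →
      freeCoords C.body J x ⊆ freeCoords C.body J x' := by
    rintro x x' hx' hxx j ⟨hj, y, hy, hne⟩
    refine ⟨hj, _, update_mem_coordSlice hxx hy
      (update_mem_body_of_agree hx' hxx hy.1 hy.2 fun l hl h => absurd h (hJ l hl)), ?_⟩
    rwa [Function.update_of_ne (ne_of_mem_of_not_mem hj hi)]
  have := restrict_uniformMeasure_coordSlice C.isDownSet_body hi hxx
    ((hsub hx' hxx).antisymm (hsub hx hxx')) (T := Set.univ) (fun y hy => ?_) (gibbs_univ hx')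
  · rwa [Measure.restrict_univ, show uniformMeasure (coordSlice C.body J x) Set.univ = 1 from
      gibbs_univ hx, one_smul] at this
  · simp only [Set.mem_univ, and_true]
    refine ⟨fun h => ?_, fun h => update_mem_body_of_agree hx' hxx h hy
      fun l hl h => absurd h (hJ l hl)⟩
    have h1 := update_mem_body_of_agree (J := J) (x := x') (x' := x) hx hxx' h (fun j hj => ?_)
      (fun l hl h => absurd h (hJ l hl))
    · rwa [Function.update_idem, ← hy i hi, Function.update_eq_self] at h1
    · by_cases hji : j = i
      · subst hji; simp
      · simp [hji, hy j hj, hxx j hji]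

/-- Raising a coordinate `i` whose only neighbour in `J` is `m` restricts the Gibbs kernel of `J`
to small values of the coordinate `m`. -/
theorem gibbs_restrict_of_adj {J : Set ι} {i m : ι} (hi : i ∉ J) (hm : m ∈ J)
    (hJ : ∀ j ∈ J, C.graph.Adj i j ↔ j = m) {x x' : ι → ℝ} (hx : x ∈ C.body) (hx' : x' ∈ C.body)
    (hxx : ∀ j ≠ i, x j = x' j) (hle : x i ≤ x' i) :
    (C.gibbs J x).restrict {y | C.r i m - C.a i * x' i < C.a m * y m}ᶜ =
      C.gibbs J x {y | C.r i m - C.a i * x' i < C.a m * y m}ᶜ •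
        (C.gibbs J x').map (fun y => Function.update y i (x i)) := by
  have him : C.graph.Adj i m := (hJ m hm).2 rfl
  have hmi : m ≠ i := him.ne'
  have ha := C.a_pos m
  have hxx' : ∀ j ≠ i, x' j = x j := fun j hj => (hxx j hj).symm
  have hr : C.a i * x' i ≤ C.r i m := mul_le_of_adj hx' him
  have hdown : ∀ y, (∀ j ∉ J, y j = x' j) → y ∈ C.body → Function.update y i (x i) ∈ C.body :=
    fun y hy hyb => update_mem_body_of_le hyb (hx.1 i).1 (by rwa [hy i hi])
  -- If the raised value forces `m` to vanish although it was free before, the free sets of the two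
  -- slices differ. Then the event has probability zero and both sides are the zero measure.
  by_cases hdeg : m ∈ freeCoords C.body J x ∧ C.a i * x' i = C.r i m
  · have h0 : C.gibbs J x {y | C.r i m - C.a i * x' i < C.a m * y m}ᶜ = 0 := by
      refine measure_mono_null (t := {y | ¬ (y ∈ coordSlice C.body J x ∧ y m ≠ 0)})
        (fun y hy => ?_) (ae_gibbs.and
          ((ae_freeCoords_ne_zero C.isDownSet_body J x).mono fun y h => h m hdeg.1))
      rintro ⟨h1, h2⟩
      have h3 : 0 < y m := lt_of_le_of_ne (h1.1.1 m).1 (Ne.symm h2)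
      refine hy ?_
      change C.r i m - C.a i * x' i < C.a m * y m
      rw [hdeg.2, sub_self]
      positivity
    rw [h0, zero_smul]
    exact Measure.restrict_eq_zero.2 h0
  · refine restrict_uniformMeasure_coordSlice C.isDownSet_body hi hxx
      (Set.Subset.antisymm ?_ ?_) (fun y hy => ?_) (gibbs_univ hx')
    · rintro j ⟨hj, y, hy, hne⟩
      -- The largest value at `m` compatible with `x' i`. Truncating a witness at `θ` moves it into
      -- the slice through `x'`, and outside the degenerate case it stays positive.
      set θ := (C.r i m - C.a i * x' i) / C.a m with hθ
      have hθ0 : 0 ≤ θ := div_nonneg (by linarith) ha.le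
      have hym : 0 ≤ y m := (hy.1.1 m).1
      have hz : Function.update y m (min (y m) θ) ∈ C.body :=
        update_mem_body_of_le hy.1 (le_min hym hθ0) (min_le_left _ _)
      have hzs : Function.update y m (min (y m) θ) ∈ coordSlice C.body J x :=
        ⟨hz, fun l hl => by
          rw [Function.update_of_ne (ne_of_mem_of_not_mem hm hl).symm, hy.2 l hl]⟩
      refine ⟨hj, _, update_mem_coordSlice hxx hzs
        (update_mem_body_of_agree hx' hxx hz hzs.2 fun l hl h => ?_), ?_⟩
      · have hlm := (hJ l hl).1 h
        subst hlm
        have : min (y l) θ ≤ θ := min_le_right _ _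
        have h2 : C.a l * min (y l) θ ≤ C.a l * θ := mul_le_mul_of_nonneg_left this ha.le
        have h3 : C.a l * θ = C.r i l - C.a i * x' i := by rw [hθ]; field_simp
        simp only [Function.update_self]
        linarith
      · rw [Function.update_of_ne (ne_of_mem_of_not_mem hj hi)]
        by_cases hjm : j = m
        · subst hjm
          rw [Function.update_self]
          have h1 : 0 < y j := lt_of_le_of_ne hym (Ne.symm hne)
          have h2 : C.a i * x' i < C.r i j :=
            lt_of_le_of_ne hr fun h => hdeg ⟨⟨hj, y, hy, hne⟩, h⟩
          exact (lt_min h1 (div_pos (by linarith) ha)).ne'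
        · rwa [Function.update_of_ne hjm]
    · rintro j ⟨hj, y, hy, hne⟩
      refine ⟨hj, _, update_mem_coordSlice hxx' hy (hdown y hy.2 hy.1), ?_⟩
      rwa [Function.update_of_ne (ne_of_mem_of_not_mem hj hi)]
    · simp only [Set.mem_compl_iff, Set.mem_ofPred_eq, not_lt]
      constructor
      · intro h
        constructor
        · have h1 := hdown _ (fun j hj => ?_) h
          · rwa [Function.update_idem, ← hy i hi, Function.update_eq_self] at h1
          · by_cases hji : j = i
            · subst hji; simp
            · simp [hji, hy j hj, hxx j hji]
        · have := h.2 i m him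
          rw [Function.update_self, Function.update_of_ne hmi] at this
          linarith
      · rintro ⟨h1, h2⟩
        refine update_mem_body_of_agree hx' hxx h1 hy fun l hl h => ?_
        rw [(hJ l hl).1 h]
        linarith

/-- A coupling argument written with integrals. Off the exceptional set the law for `x` is, apart
from the coordinate `i`, a multiple of the law for `x'`. On that set a sample `y` is compared with
an independent sample for `x'`, which is necessarily smaller at `m`, so the cost is `g (y m)`. -/
theorem within_lintegral_gibbs_of_adj {J : Set ι} {i m : ι} (hi : i ∉ J) (hm : m ∈ J)
    (hJ : ∀ j ∈ J, C.graph.Adj i j ↔ j = m) {x x' : ι → ℝ} (hx : x ∈ C.body) (hx' : x' ∈ C.body)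
    (hxx : ∀ j ≠ i, x j = x' j) (hle : x i ≤ x' i) {f : (ι → ℝ) → ℝ≥0∞} (hf : Measurable f)
    {g : ℝ → ℝ≥0∞} (hg : Measurable g) {d : ℝ≥0∞}
    (hd : ∀ z ∈ coordSlice C.body J x', Within d (f (Function.update z i (x i))) (f z))
    (hfg : ∀ y ∈ coordSlice C.body J x, ∀ w ∈ coordSlice C.body J x, w m ≤ y m →
      Within (g (y m)) (f y) (f w)) :
    Within ((∫⁻ y in {y | C.r i m - C.a i * x' i < C.a m * y m}, g (y m) ∂C.gibbs J x) + d)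
      (∫⁻ y, f y ∂C.gibbs J x) (∫⁻ y, f y ∂C.gibbs J x') := by
  have ha := C.a_pos m
  have hmi : m ≠ i := fun h => hi (h ▸ hm)
  have hxx' : ∀ j ≠ i, x' j = x j := fun j hj => (hxx j hj).symm
  set B := {y : ι → ℝ | C.r i m - C.a i * x' i < C.a m * y m} with hB
  have hBm : MeasurableSet B :=
    measurableSet_lt measurable_const ((measurable_pi_apply m).const_mul _)
  have hup : Measurable (fun y : ι → ℝ => Function.update y i (x i)) := measurable_update_left
  have hgm : Measurable fun y : ι → ℝ => g (y m) := hg.comp (measurable_pi_apply m)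
  set e := ∫⁻ z, f (Function.update z i (x i)) ∂C.gibbs J x' with he
  -- The intermediate value `e` uses the law for `x'` with coordinate `i` reset to `x i`; undoing
  -- the reset costs `d`.
  refine Within.trans (v := e) ?_ (within_lintegral (gibbs_univ hx') (ae_gibbs.mono hd))
  have hT : ∫⁻ y in Bᶜ, f y ∂C.gibbs J x = C.gibbs J x Bᶜ * e := by
    rw [gibbs_restrict_of_adj hi hm hJ hx hx' hxx hle, lintegral_smul_measure,
      lintegral_map hf hup, smul_eq_mul]
  have hpt : ∀ y ∈ coordSlice C.body J x, y ∈ B → Within (g (y m)) (f y) e := by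
    intro y hy hyB
    have hconst : f y = ∫⁻ _, f y ∂C.gibbs J x' := by
      rw [lintegral_const, gibbs_univ hx', mul_one]
    rw [hconst]
    refine within_lintegral (gibbs_univ hx') (ae_gibbs.mono fun z hz => ?_)
    have hw : Function.update z i (x i) ∈ coordSlice C.body J x :=
      update_mem_coordSlice hxx' hz
        (update_mem_body_of_le hz.1 (hx.1 i).1 (by rwa [hz.2 i hi]))
    refine hfg y hy _ hw ?_
    rw [Function.update_of_ne hmi]
    have h1 := hz.1.2 i m ((hJ m hm).2 rfl)
    rw [hz.2 i hi] at h1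
    have h2 : C.r i m - C.a i * x' i < C.a m * y m := hyB
    exact (lt_of_mul_lt_mul_left (by linarith) ha.le).le
  have hae : ∀ᵐ y ∂(C.gibbs J x).restrict B, Within (g (y m)) (f y) e := by
    rw [ae_restrict_iff' hBm]
    exact ae_gibbs.mono hpt
  have hmass : C.gibbs J x B + C.gibbs J x Bᶜ = 1 := by
    rw [measure_add_measure_compl hBm, gibbs_univ hx]
  have he' : e = C.gibbs J x B * e + C.gibbs J x Bᶜ * e := by rw [← add_mul, hmass, one_mul]
  rw [← lintegral_add_compl f hBm, hT]
  constructor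
  · calc _ ≤ (∫⁻ y in B, (e + g (y m)) ∂C.gibbs J x) + C.gibbs J x Bᶜ * e := by
          gcongr ?_ + _
          exact lintegral_mono_ae (hae.mono fun y h => h.1)
      _ = (C.gibbs J x B * e + C.gibbs J x Bᶜ * e) + ∫⁻ y in B, g (y m) ∂C.gibbs J x := by
          rw [lintegral_add_right _ hgm, setLIntegral_const]
          ring
      _ = _ := by rw [← he']
  · calc e = (∫⁻ _ in B, e ∂C.gibbs J x) + C.gibbs J x Bᶜ * e := by
          rw [setLIntegral_const, mul_comm e, ← he']
      _ ≤ (∫⁻ y in B, (f y + g (y m)) ∂C.gibbs J x) + C.gibbs J x Bᶜ * e := by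
          gcongr ?_ + _
          exact lintegral_mono_ae (hae.mono fun y h => h.2)
      _ = _ := by
          rw [lintegral_add_right _ hgm]
          ring

end PairConstraints

/-! ### Discrepancies travelling along a path -/

/-- The vertices `e 1, …, e k`. -/
def pathBlock {ι : Type} (e : ℕ → ι) (k : ℕ) : Set ι := {j | ∃ t, 1 ≤ t ∧ t ≤ k ∧ e t = j}

/-- The expected `c`-weighted number of discrepancies which a discrepancy at `e 0` creates in the
block `e 1, …, e k`, bounded under the assumption that two successive sites are in agreement with
probability at least `1/2`. -/
noncomputable def spread {ι : Type} (c : ι → ℝ) : ℕ → (ℕ → ι) → ℝ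
  | 0, _ => 0
  | 1, e => c (e 1)
  | k + 2, e => c (e 1) + (c (e 2) + spread c k fun t => e (t + 2)) / 2

theorem spread_nonneg {ι : Type} {c : ι → ℝ} (hc : ∀ i, 0 ≤ c i) :
    ∀ (k : ℕ) (e : ℕ → ι), 0 ≤ spread c k e
  | 0, _ => le_rfl
  | 1, e => hc (e 1)
  | k + 2, e => by
    have := spread_nonneg hc k fun t => e (t + 2)
    have := hc (e 1)
    have := hc (e 2)
    rw [spread]
    positivity

namespace PairConstraints

variable {ι : Type} {C : PairConstraints ι}

variable (C) in
/-- The vertices `e 0, …, e k` form an induced path. -/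
structure InducedPath (e : ℕ → ι) (k : ℕ) : Prop where
  inj : ∀ s t, s ≤ k → t ≤ k → e s = e t → s = t
  adj : ∀ s t, s ≤ k → t ≤ k → (C.graph.Adj (e s) (e t) ↔ s + 1 = t ∨ t + 1 = s)

theorem InducedPath.tail {e : ℕ → ι} {k : ℕ} (h : C.InducedPath e (k + 1)) :
    C.InducedPath (fun t => e (t + 1)) k :=
  ⟨fun s t hs ht hst => by
      have := h.inj (s + 1) (t + 1) (by omega) (by omega) hst
      omega,
    fun s t hs ht => by
      rw [h.adj (s + 1) (t + 1) (by omega) (by omega)]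
      omega⟩

theorem InducedPath.notMem_pathBlock {e : ℕ → ι} {k : ℕ} (h : C.InducedPath e k) :
    e 0 ∉ pathBlock e k := by
  rintro ⟨t, h1, h2, h3⟩
  have := h.inj t 0 h2 (by omega) h3
  omega

theorem mem_pathBlock_succ {e : ℕ → ι} {k : ℕ} {j : ι} :
    j ∈ pathBlock e (k + 1) ↔ j = e 1 ∨ j ∈ pathBlock (fun t => e (t + 1)) k := by
  constructor
  · rintro ⟨t, h1, h2, rfl⟩
    by_cases ht : t = 1
    · exact Or.inl (by rw [ht])
    · exact Or.inr ⟨t - 1, by omega, by omega, by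
        change e (t - 1 + 1) = e t
        congr 1
        omega⟩
  · rintro (rfl | ⟨t, h1, h2, rfl⟩)
    · exact ⟨1, le_rfl, by omega, rfl⟩
    · exact ⟨t + 1, by omega, by omega, rfl⟩

variable (C) in
/-- Changing the coordinate `j` within the polytope changes `f` by at most `c j`. -/
def CoordLip (c : ι → ℝ) (f : (ι → ℝ) → ℝ≥0∞) : Prop :=
  ∀ j, ∀ x ∈ C.body, ∀ x' ∈ C.body, (∀ l ≠ j, x l = x' l) → f x ≤ f x' + ENNReal.ofReal (c j)

theorem CoordLip.within {c : ι → ℝ} {f : (ι → ℝ) → ℝ≥0∞} (h : C.CoordLip c f) {j : ι}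
    {x x' : ι → ℝ} (hx : x ∈ C.body) (hx' : x' ∈ C.body) (hxx : ∀ l ≠ j, x l = x' l) :
    Within (ENNReal.ofReal (c j)) (f x) (f x') :=
  ⟨h j x hx x' hx' hxx, h j x' hx' x hx fun l hl => (hxx l hl).symm⟩

variable [Fintype ι] [DecidableEq ι]

/-- The two resampled states can be taken equal away from `i`, so only the original discrepancy
remains. -/
theorem within_gibbs_of_not_adj {J : Set ι} {i : ι} (hi : i ∉ J)
    (hJ : ∀ j ∈ J, ¬ C.graph.Adj i j) {x x' : ι → ℝ} (hx : x ∈ C.body) (hx' : x' ∈ C.body)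
    (hxx : ∀ j ≠ i, x j = x' j) {c : ι → ℝ} {f : (ι → ℝ) → ℝ≥0∞} (hf : Measurable f)
    (hc : C.CoordLip c f) :
    Within (ENNReal.ofReal (c i)) (∫⁻ y, f y ∂C.gibbs J x) (∫⁻ y, f y ∂C.gibbs J x') := by
  rw [gibbs_eq_map_of_not_adj hi hJ hx hx' hxx, lintegral_map hf measurable_update_left]
  refine within_lintegral (gibbs_univ hx') (ae_gibbs.mono fun y hy => hc.within ?_ hy.1 ?_)
  · exact update_mem_body_of_agree hx (fun j hj => (hxx j hj).symm) hy.1 hy.2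
      fun l hl h => absurd h (hJ l hl)
  · intro l hl
    simp [hl]

/-- The general step: resampling `e 1, …, e (k + 1)` may be done by resampling `e 2, …, e (k + 1)`
in the end, so it suffices to compare the result of the latter for different values at `e 1`. -/
theorem within_gibbs_pathBlock_succ {e : ℕ → ι} {k : ℕ} (he : C.InducedPath e (k + 1))
    {x x' : ι → ℝ} (hx : x ∈ C.body) (hx' : x' ∈ C.body) (hxx : ∀ j ≠ e 0, x j = x' j)
    (hle : x (e 0) ≤ x' (e 0)) {c : ι → ℝ} {f : (ι → ℝ) → ℝ≥0∞} (hf : Measurable f)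
    (hc : C.CoordLip c f) {g : ℝ → ℝ≥0∞} (hg : Measurable g)
    (hfg : ∀ y ∈ C.body, ∀ w ∈ C.body, (∀ j ≠ e 1, w j = y j) → w (e 1) ≤ y (e 1) →
      Within (g (y (e 1))) (∫⁻ z, f z ∂C.gibbs (pathBlock (fun t => e (t + 1)) k) y)
        (∫⁻ z, f z ∂C.gibbs (pathBlock (fun t => e (t + 1)) k) w)) :
    Within ((∫⁻ y in {y | C.r (e 0) (e 1) - C.a (e 0) * x' (e 0) < C.a (e 1) * y (e 1)},
        g (y (e 1)) ∂C.gibbs (pathBlock e (k + 1)) x) + ENNReal.ofReal (c (e 0)))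
      (∫⁻ y, f y ∂C.gibbs (pathBlock e (k + 1)) x) (∫⁻ y, f y ∂C.gibbs (pathBlock e (k + 1)) x') := by
  have hsub : pathBlock (fun t => e (t + 1)) k ⊆ pathBlock e (k + 1) :=
    fun j hj => mem_pathBlock_succ.2 (Or.inr hj)
  have h0 : e 0 ∉ pathBlock e (k + 1) := he.notMem_pathBlock
  have h1 : e 1 ∈ pathBlock e (k + 1) := mem_pathBlock_succ.2 (Or.inl rfl)
  have hadj : ∀ j ∈ pathBlock e (k + 1), C.graph.Adj (e 0) j ↔ j = e 1 := by
    rintro _ ⟨t, ht1, ht2, rfl⟩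
    rw [he.adj 0 t (by omega) ht2]
    refine ⟨fun h => by congr 1; omega, fun h => ?_⟩
    have := he.inj t 1 ht2 (by omega) h
    omega
  have hnadj : ∀ j ∈ pathBlock (fun t => e (t + 1)) k, ¬ C.graph.Adj (e 0) j := by
    intro j hj h
    have := (hadj j (hsub hj)).1 h
    rw [this] at hj
    exact he.tail.notMem_pathBlock hj
  rw [← lintegral_lintegral_gibbs hsub x hf, ← lintegral_lintegral_gibbs hsub x' hf]
  refine within_lintegral_gibbs_of_adj h0 h1 hadj hx hx' hxx hle
    (measurable_lintegral_gibbs _ hf) hg (fun z hz => ?_) fun y hy w hw hwy => ?_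
  · refine within_gibbs_of_not_adj (fun h => h0 (hsub h)) hnadj
      (update_mem_body_of_le hz.1 (hx.1 _).1 (by rwa [hz.2 _ h0])) hz.1 (fun l hl => ?_) hf hc
    simp [hl]
  · have hw' : Function.update y (e 1) (w (e 1)) ∈ C.body :=
      update_mem_body_of_le hy.1 (hw.1.1 _).1 hwy
    rw [lintegral_gibbs_congr (x := w) (y := Function.update y (e 1) (w (e 1))) _ f]
    · exact hfg y hy.1 _ hw' (fun j hj => by simp [hj]) (by simpa using hwy)
    · intro j hj
      by_cases hj1 : j = e 1
      · subst hj1; simp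
      · have : j ∉ pathBlock e (k + 1) := fun h => (mem_pathBlock_succ.1 h).elim hj1 hj
        simp [hj1, hy.2 j this, hw.2 j this]

/-- A small discrepancy is likely to disappear at the next site. -/
theorem within_gibbs_pathBlock_of_small {e : ℕ → ι} {k : ℕ} (he : C.InducedPath e (k + 1))
    {x x' : ι → ℝ} (hx : x ∈ C.body) (hx' : x' ∈ C.body) (hxx : ∀ j ≠ e 0, x j = x' j)
    (hle : x (e 0) ≤ x' (e 0)) {c : ι → ℝ} (hc0 : ∀ i, 0 ≤ c i) {f : (ι → ℝ) → ℝ≥0∞}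
    (hf : Measurable f) (hc : C.CoordLip c f) {K : ℝ} (hK0 : 0 ≤ K)
    (hK : ∀ y ∈ C.body, ∀ w ∈ C.body, (∀ j ≠ e 1, w j = y j) →
      Within (ENNReal.ofReal K) (∫⁻ z, f z ∂C.gibbs (pathBlock (fun t => e (t + 1)) k) y)
        (∫⁻ z, f z ∂C.gibbs (pathBlock (fun t => e (t + 1)) k) w)) :
    Within (ENNReal.ofReal (c (e 0) + C.a (e 0) * x' (e 0) / C.r (e 0) (e 1) * K))
      (∫⁻ y, f y ∂C.gibbs (pathBlock e (k + 1)) x) (∫⁻ y, f y ∂C.gibbs (pathBlock e (k + 1)) x') := by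
  have hadj : C.graph.Adj (e 0) (e 1) := (he.adj 0 1 (by omega) (by omega)).2 (Or.inl rfl)
  have hr := C.r_pos _ _ hadj
  have hax : 0 ≤ C.a (e 0) * x' (e 0) := mul_nonneg (C.a_pos _).le (hx'.1 _).1
  refine (within_gibbs_pathBlock_succ he hx hx' hxx hle hf hc (g := fun _ => ENNReal.ofReal K)
    measurable_const fun y hy w hw h _ => hK y hy w hw h).mono ?_
  rw [setLIntegral_const, add_comm (c (e 0)), ENNReal.ofReal_add (by positivity) (hc0 _),
    ENNReal.ofReal_mul (by positivity), mul_comm (ENNReal.ofReal K)]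
  gcongr
  exact gibbs_tail_le hx (mem_pathBlock_succ.2 (Or.inl rfl)) (fun z hz => by
    have := mul_le_of_adj hz hadj.symm
    rwa [C.r_symm] at this) (mul_le_of_adj hx' hadj) hr

/-- The influence of a coordinate on the Gibbs kernel of an adjacent path. -/
theorem within_gibbs_pathBlock {c : ι → ℝ} (hc0 : ∀ i, 0 ≤ c i) {f : (ι → ℝ) → ℝ≥0∞}
    (hf : Measurable f) (hc : C.CoordLip c f) : ∀ (k : ℕ) (e : ℕ → ι), C.InducedPath e k →
    ∀ x ∈ C.body, ∀ x' ∈ C.body, (∀ j ≠ e 0, x j = x' j) →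
    Within (ENNReal.ofReal (c (e 0) + spread c k e))
      (∫⁻ y, f y ∂C.gibbs (pathBlock e k) x) (∫⁻ y, f y ∂C.gibbs (pathBlock e k) x') := by
  have key : ∀ (k : ℕ) (e : ℕ → ι), (∀ x ∈ C.body, ∀ x' ∈ C.body, (∀ j ≠ e 0, x j = x' j) →
      x (e 0) ≤ x' (e 0) → Within (ENNReal.ofReal (c (e 0) + spread c k e))
      (∫⁻ y, f y ∂C.gibbs (pathBlock e k) x) (∫⁻ y, f y ∂C.gibbs (pathBlock e k) x')) →
      ∀ x ∈ C.body, ∀ x' ∈ C.body, (∀ j ≠ e 0, x j = x' j) →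
      Within (ENNReal.ofReal (c (e 0) + spread c k e))
      (∫⁻ y, f y ∂C.gibbs (pathBlock e k) x) (∫⁻ y, f y ∂C.gibbs (pathBlock e k) x') := by
    intro k e h x hx x' hx' hxx
    rcases le_total (x (e 0)) (x' (e 0)) with hle | hle
    · exact h x hx x' hx' hxx hle
    · exact (h x' hx' x hx (fun j hj => (hxx j hj).symm) hle).symm
  have hzero : ∀ (e : ℕ → ι), ∀ x ∈ C.body, ∫⁻ y, f y ∂C.gibbs (pathBlock e 0) x = f x := by
    intro e x hx
    refine lintegral_gibbs_of_forall_mem hx fun y hy => ?_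
    congr 1
    funext j
    refine hy.2 j ?_
    rintro ⟨t, h1, h2, -⟩
    omega
  intro k
  induction k using Nat.strong_induction_on with
  | _ k ih =>
    match k, ih with
    | 0, _ =>
      intro e _ x hx x' hx' hxx
      rw [hzero e x hx, hzero e x' hx', spread, add_zero]
      exact hc.within hx hx' hxx
    | 1, _ =>
      intro e he
      refine key 1 e fun x hx x' hx' hxx hle => ?_
      refine (within_gibbs_pathBlock_succ he hx hx' hxx hle hf hc
        (g := fun _ => ENNReal.ofReal (c (e 1))) measurable_const
        fun y hy w hw h _ => ?_).mono ?_
      · rw [hzero _ y hy, hzero _ w hw]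
        exact hc.within hy hw fun j hj => (h j hj).symm
      · rw [spread, add_comm (c (e 0)), ENNReal.ofReal_add (hc0 _) (hc0 _)]
        gcongr
        refine (setLIntegral_le_lintegral _ _).trans ?_
        rw [lintegral_const, gibbs_univ hx, mul_one]
    | k + 2, ih =>
      intro e he
      refine key (k + 2) e fun x hx x' hx' hxx hle => ?_
      have hadj : C.graph.Adj (e 1) (e 2) := (he.adj 1 2 (by omega) (by omega)).2 (Or.inl rfl)
      have hr := C.r_pos _ _ hadj
      set K := c (e 2) + spread c k fun t => e (t + 2) with hKdef
      have hK0 : 0 ≤ K := add_nonneg (hc0 _) (spread_nonneg hc0 _ _)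
      have hap := C.a_pos (e 1)
      have h1mem : e 1 ∈ pathBlock e (k + 1 + 1) := mem_pathBlock_succ.2 (Or.inl rfl)
      -- `g t` is the cost of a discrepancy at `e 1` whose larger value is `t`: it counts `c (e 1)`
      -- itself and passes to `e 2` with probability at most `a t / r`, at cost `K`.
      refine (within_gibbs_pathBlock_succ (k := k + 1) he hx hx' hxx hle hf hc
        (g := fun t => ENNReal.ofReal (c (e 1)) +
          ENNReal.ofReal (C.a (e 1) * t) * ENNReal.ofReal (K / C.r (e 1) (e 2)))
        (by fun_prop) fun y hy w hw h hwy => ?_).mono ?_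
      · have h1 := within_gibbs_pathBlock_of_small he.tail hw hy h hwy hc0 hf hc hK0
          fun y hy w hw h => ih k (by omega) (fun t => e (t + 2)) he.tail.tail y hy w hw
            fun j hj => (h j hj).symm
        refine h1.symm.mono ?_
        have h2 : 0 ≤ C.a (e 1) * y (e 1) := mul_nonneg hap.le (hy.1 _).1
        rw [← ENNReal.ofReal_mul h2, ← ENNReal.ofReal_add (hc0 _) (by positivity)]
        refine ENNReal.ofReal_le_ofReal (le_of_eq ?_)
        simp only [zero_add]
        ring
      · rw [spread, add_comm (c (e 0)), ENNReal.ofReal_add (add_nonneg (hc0 _) (by positivity))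
          (hc0 _), ENNReal.ofReal_add (hc0 _) (by positivity)]
        gcongr
        -- The restriction to the exceptional event is dropped, so `e 1` counts as a sure
        -- discrepancy. The mean of `a * y (e 1)` is at most `r / 2`, which halves `K`.
        refine (setLIntegral_le_lintegral _ _).trans ?_
        rw [lintegral_add_left measurable_const, lintegral_const, gibbs_univ hx, mul_one,
          lintegral_mul_const _ (by fun_prop)]
        gcongr
        calc _ ≤ ENNReal.ofReal (C.r (e 1) (e 2) / 2) * ENNReal.ofReal (K / C.r (e 1) (e 2)) := by
              gcongr
              exact lintegral_gibbs_mul_le hx h1mem fun z hz => mul_le_of_adj hz hadj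
          _ = ENNReal.ofReal (K / 2) := by
              rw [← ENNReal.ofReal_mul (by positivity)]
              congr 1
              field_simp

end PairConstraints

/-! ### From single coordinates to arbitrary pairs of states -/

namespace PairConstraints

variable {ι : Type} {C : PairConstraints ι}

variable [Fintype ι]

/-- The coordinates are lowered one at a time; all intermediate points lie below `x` and thus stay
in the polytope. -/
theorem CoordLip.within_of_le {c : ι → ℝ} (hc : ∀ i, 0 ≤ c i) {f : (ι → ℝ) → ℝ≥0∞}
    (h : C.CoordLip c f) {x z : ι → ℝ} (hx : x ∈ C.body) (hz : z ∈ C.body) (hzx : ∀ j, z j ≤ x j) :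
    Within (ENNReal.ofReal (∑ j, c j)) (f x) (f z) := by
  classical
  have key : ∀ s : Finset ι, Within (ENNReal.ofReal (∑ j ∈ s, c j)) (f x)
      (f fun j => if j ∈ s then z j else x j) := by
    intro s
    have hmem : ∀ s : Finset ι, (fun j => if j ∈ s then z j else x j) ∈ C.body := fun s =>
      mem_body_of_le hx (fun j => by
        split_ifs
        · exact (hz.1 j).1
        · exact (hx.1 j).1) fun j => by
        split_ifs
        · exact hzx j
        · exact le_rfl
    induction s using Finset.induction_on with
    | empty => simp [Within]
    | insert i s hi ih =>
      rw [Finset.sum_insert hi, add_comm,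
        ENNReal.ofReal_add (Finset.sum_nonneg fun j _ => hc j) (hc i)]
      refine ih.trans (h.within (hmem s) (hmem _) fun l hl => ?_)
      simp [Finset.mem_insert, hl]
  simpa using key Finset.univ

/-- Replacing coordinates of `x` by those of `y` directly could leave the polytope, so the path goes
down to the coordinatewise minimum and up again. Hence the factor `2`. -/
theorem CoordLip.within_sum {c : ι → ℝ} (hc : ∀ i, 0 ≤ c i) {f : (ι → ℝ) → ℝ≥0∞}
    (h : C.CoordLip c f) {x y : ι → ℝ} (hx : x ∈ C.body) (hy : y ∈ C.body) :
    Within (ENNReal.ofReal (2 * ∑ j, c j)) (f x) (f y) := by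
  have hz : (fun j => min (x j) (y j)) ∈ C.body :=
    mem_body_of_le hx (fun j => le_min (hx.1 j).1 (hy.1 j).1) fun j => min_le_left _ _
  have h0 : 0 ≤ ∑ j, c j := Finset.sum_nonneg fun j _ => hc j
  rw [two_mul, ENNReal.ofReal_add h0 h0]
  exact (h.within_of_le hc hx hz fun j => min_le_left _ _).trans
    (h.within_of_le hc hy hz fun j => min_le_right _ _).symm

end PairConstraints

open PairConstraints

/-! ### The polytope of reversible tridiagonal matrices -/

/-- The constraints defining `bdPolytope n π`. -/
noncomputable def bdConstraints (n : ℕ) (π : ℕ → ℝ) (hπ : IsFullDistribution n π) :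
    PairConstraints (Fin (n - 1)) where
  graph :=
    { Adj := fun i j => (i : ℕ) + 1 = j ∨ (j : ℕ) + 1 = i
      symm := ⟨fun _ _ h => h.symm⟩
      loopless := ⟨fun i h => by omega⟩ }
  a j := π (j + 1)
  b j := min 1 (π (j + 2) / π (j + 1))
  r i j := π (max i j + 1)
  a_pos j := hπ.1 _ (Finset.mem_Icc.2 (by omega))
  b_pos j := lt_min one_pos (div_pos (hπ.1 _ (Finset.mem_Icc.2 (by omega)))
    (hπ.1 _ (Finset.mem_Icc.2 (by omega))))
  r_pos i j _ := hπ.1 _ (Finset.mem_Icc.2 (by omega))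
  r_symm i j := by rw [max_comm]

/-- After clearing denominators, both bounds in the definition are instances of `π i * X[i] + π (i +
1) * X[i + 1] ≤ π (i + 1)`, at consecutive indices. At the two ends the conventions for `X[0]` and
`X[n]` leave box constraints, and the box constraints elsewhere are implied. -/
theorem body_bdConstraints {n : ℕ} {π : ℕ → ℝ} (hπ : IsFullDistribution n π) :
    (bdConstraints n π hπ).body = bdPolytope n π := by
  have hpos : ∀ q, 1 ≤ q → q ≤ n → 0 < π q := fun q h1 h2 => hπ.1 q (Finset.mem_Icc.2 ⟨h1, h2⟩)
  ext X
  constructor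
  · intro hX q hq
    rw [Finset.mem_Icc] at hq
    obtain ⟨j, rfl⟩ : ∃ j : Fin (n - 1), (j : ℕ) + 1 = q := ⟨⟨q - 1, by omega⟩, by simp; omega⟩
    have hb := (hX.1 j).2
    have hp := hpos (j + 1) (by omega) (by omega)
    rw [entry_succ]
    refine ⟨(hX.1 j).1, le_min ?_ ?_⟩
    · rcases Nat.eq_zero_or_pos (j : ℕ) with h0 | h0
      · rw [h0]
        simpa [entry] using hb.trans (min_le_left _ _)
      · obtain ⟨i, hi⟩ : ∃ i : Fin (n - 1), (i : ℕ) + 1 = j := ⟨⟨j - 1, by omega⟩, by simp; omega⟩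
        have h1 : π (i + 1) * X i + π (j + 1) * X j ≤ π (max (i : ℕ) j + 1) := hX.2 i j (Or.inl hi)
        rw [max_eq_right (by omega)] at h1
        rw [Nat.add_sub_cancel, ← hi, entry_succ]
        rw [← hi] at h1
        have : X j ≤ (π (i + 1 + 1) - π (i + 1) * X i) / π (i + 1 + 1) := by
          rw [le_div_iff₀ (by rwa [hi])]
          linarith
        refine this.trans (le_of_eq ?_)
        have hp' : π (i + 1 + 1) ≠ 0 := by rw [hi]; exact hp.ne'
        field_simp
    · by_cases hlast : (j : ℕ) + 1 < n - 1
      · have h1 : π (j + 1) * X j + π (j + 1 + 1) * X ⟨j + 1, hlast⟩ ≤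
            π (max (j : ℕ) (j + 1) + 1) := hX.2 j ⟨j + 1, hlast⟩ (Or.inl rfl)
        rw [max_eq_right (by omega)] at h1
        have h2 := entry_succ X ⟨(j : ℕ) + 1, hlast⟩
        rw [h2, div_mul_eq_mul_div, le_div_iff₀ hp]
        linarith
      · have h2 : entry X ((j : ℕ) + 1 + 1) = 0 := by
          simp only [entry]
          rw [dif_neg (by omega)]
        rw [h2, sub_zero, mul_one]
        exact hb.trans (min_le_right _ _)
  · intro hX
    have h0 : ∀ i, 0 ≤ entry X i := by
      intro i
      by_cases hi : 1 ≤ i ∧ i ≤ n - 1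
      · exact (hX i (Finset.mem_Icc.2 hi)).1
      · simp [entry, hi]
    have hself : ∀ j : Fin (n - 1), (j : ℕ) + 1 ∈ Finset.Icc 1 (n - 1) :=
      fun j => Finset.mem_Icc.2 (by omega)
    have hpair : ∀ i j : Fin (n - 1), (i : ℕ) + 1 = j →
        π (i + 1) * X i + π (j + 1) * X j ≤ π (max (i : ℕ) j + 1) := by
      intro i j hij
      have h1 := (hX _ (hself j)).2.trans (min_le_left _ _)
      rw [Nat.add_sub_cancel, entry_succ, ← hij, entry_succ] at h1
      have hp := hpos (i + 1 + 1) (by omega) (by omega)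
      rw [max_eq_right (by omega), ← hij]
      have h2 := mul_le_mul_of_nonneg_left h1 hp.le
      have h3 : π (i + 1 + 1) * (1 - π (i + 1) / π (i + 1 + 1) * X i) =
          π (i + 1 + 1) - π (i + 1) * X i := by field_simp
      linarith
    refine ⟨fun j => ⟨?_, le_min ?_ ?_⟩, fun i j hij => ?_⟩
    · have := h0 (j + 1)
      rwa [entry_succ] at this
    · have h1 := (hX _ (hself j)).2.trans (min_le_left _ _)
      rw [Nat.add_sub_cancel, entry_succ] at h1
      refine h1.trans (sub_le_self _ ?_)
      rcases Nat.eq_zero_or_pos (j : ℕ) with hz | hz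
      · simp [hz, entry]
      · exact mul_nonneg (div_pos (hpos _ hz (by omega)) (hpos _ (by omega) (by omega))).le (h0 _)
    · have h1 := (hX _ (hself j)).2.trans (min_le_right _ _)
      rw [entry_succ] at h1
      refine h1.trans (mul_le_of_le_one_right ?_ (by linarith [h0 (j + 1 + 1)]))
      exact (div_pos (hpos _ (by omega) (by omega)) (hpos _ (by omega) (by omega))).le
    · change π (i + 1) * X i + π (j + 1) * X j ≤ π (max (i : ℕ) j + 1)
      rcases hij with hij | hij
      · exact hpair i j hij
      · rw [max_comm, add_comm (π (i + 1) * X i)]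
        exact hpair j i hij

/-- The uniform distribution on the polytope is the Gibbs kernel resampling everything. -/
theorem bdUniform_eq_gibbs {n : ℕ} {π : ℕ → ℝ} (hπ : IsFullDistribution n π)
    (x : Fin (n - 1) → ℝ) :
    bdUniform n π = (bdConstraints n π hπ).gibbs Set.univ x := by
  classical
  set C := bdConstraints n π hπ with hC
  have hslice : coordSlice C.body Set.univ x = C.body := by
    ext y; simp [coordSlice]
  -- A small positive multiple of the `j`-th unit vector satisfies all constraints, so no coordinate
  -- is forced to vanish and the dimension is full.
  have hfree : freeCoords C.body Set.univ x = Set.univ := by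
    refine Set.eq_univ_of_forall fun j => ⟨Set.mem_univ j, ?_⟩
    rw [hslice]
    have hmin : 0 < min (C.b j) (Finset.univ.inf' ⟨j, Finset.mem_univ j⟩
        fun l => if C.graph.Adj j l then C.r j l / C.a j else C.b j) := by
      refine lt_min (C.b_pos j) ((Finset.lt_inf'_iff _).2 fun l _ => ?_)
      split_ifs with h
      · exact div_pos (C.r_pos _ _ h) (C.a_pos _)
      · exact C.b_pos j
    set ε := min (C.b j) (Finset.univ.inf' ⟨j, Finset.mem_univ j⟩
        fun l => if C.graph.Adj j l then C.r j l / C.a j else C.b j) with hε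
    have hr : ∀ l, C.graph.Adj j l → C.a j * ε ≤ C.r j l := by
      intro l hl
      have h1 : ε ≤ C.r j l / C.a j := by
        refine (min_le_right _ _).trans ((Finset.inf'_le _ (Finset.mem_univ l)).trans_eq ?_)
        rw [if_pos hl]
      rw [le_div_iff₀ (C.a_pos j)] at h1
      linarith
    refine ⟨Function.update 0 j ε, ⟨fun i => ?_, fun i l hil => ?_⟩, by simpa using hmin.ne'⟩
    · by_cases hi : i = j
      · subst hi
        simpa using ⟨hmin.le, min_le_left _ _⟩
      · simpa [hi] using (C.b_pos i).le
    · by_cases hi : i = j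
      · subst hi
        simpa [hil.ne'] using hr l hil
      · by_cases hl : l = j
        · subst hl
          have := hr i hil.symm
          rw [C.r_symm] at this
          simpa [hi] using this
        · simpa [hi, hl] using (C.r_pos _ _ hil).le
  have hfin : Module.finrank ℝ (vectorSpan ℝ C.body) = Fintype.card (Fin (n - 1)) := by
    have := finrank_vectorSpan_coordSlice C.isDownSet_body Set.univ x
    rw [hslice] at this
    rw [this, ← Fintype.card_congr (Equiv.Set.univ (Fin (n - 1)))]
    exact Fintype.card_congr (Equiv.setCongr hfree)
  rw [gibbs, hslice, uniformMeasure, hfin, hausdorffMeasure_pi_real, bdUniform,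
    ← body_bdConstraints hπ]

theorem zero_mem_bdPolytope {n : ℕ} {π : ℕ → ℝ} (hπ : IsFullDistribution n π) :
    (0 : Fin (n - 1) → ℝ) ∈ bdPolytope n π := by
  rw [← body_bdConstraints hπ]
  exact ⟨fun i => by simpa using ((bdConstraints n π hπ).b_pos i).le,
    fun i j h => by simpa using ((bdConstraints n π hπ).r_pos i j h).le⟩

/-! ### The transition operator and its stationary law -/

/-- The transition operator of the block Gibbs sampler. -/
noncomputable def blockOp (n k : ℕ) (w : ℝ) (π : ℕ → ℝ) (f : (Fin (n - 1) → ℝ) → ℝ≥0∞)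
    (x : Fin (n - 1) → ℝ) : ℝ≥0∞ := ∫⁻ y, f y ∂blockStep n k w π x

section BlockOp

variable {n : ℕ} {π : ℕ → ℝ} (k : ℕ) (w : ℝ)

theorem blockOp_apply (hπ : IsFullDistribution n π) (f : (Fin (n - 1) → ℝ) → ℝ≥0∞)
    (x : Fin (n - 1) → ℝ) :
    blockOp n k w π f x = ∑ i ∈ Finset.Icc 1 (n - k), ENNReal.ofReal (blockProb n k w i) *
      ∫⁻ y, f y ∂(bdConstraints n π hπ).gibbs (block n k i) x := by
  rw [blockOp, blockStep, lintegral_finsetSum_measure]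
  simp only [lintegral_smul_measure, smul_eq_mul, gibbs, body_bdConstraints]

theorem measurable_blockOp (hπ : IsFullDistribution n π) {f : (Fin (n - 1) → ℝ) → ℝ≥0∞}
    (hf : Measurable f) : Measurable (blockOp n k w π f) :=
  (Measure.measurable_lintegral hf).comp (measurable_blockStep k w hπ)

theorem measurable_iterate_blockOp (hπ : IsFullDistribution n π)
    {f : (Fin (n - 1) → ℝ) → ℝ≥0∞} (hf : Measurable f) (t : ℕ) :
    Measurable ((blockOp n k w π)^[t] f) := by
  induction t with
  | zero => exact hf
  | succ t ih =>
    rw [Function.iterate_succ_apply']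
    exact measurable_blockOp k w hπ ih

/-- Duality: the law at time `t` is studied through iterates of the operator on test functions,
where `CoordLip` can be propagated. -/
theorem lintegral_blockLaw (hπ : IsFullDistribution n π) (x : Fin (n - 1) → ℝ) (t : ℕ)
    {f : (Fin (n - 1) → ℝ) → ℝ≥0∞} (hf : Measurable f) :
    ∫⁻ y, f y ∂blockLaw n k w π x t = (blockOp n k w π)^[t] f x := by
  induction t generalizing f with
  | zero => exact lintegral_dirac' x hf
  | succ t ih =>
    rw [blockLaw, Measure.lintegral_bind (measurable_blockStep k w hπ).aemeasurable
      hf.aemeasurable, Function.iterate_succ_apply, ← ih (measurable_blockOp k w hπ hf)]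
    rfl

/-- Stationarity: the uniform law is the kernel resampling all coordinates, and by consistency each
block kernel preserves it. -/
theorem lintegral_blockOp_bdUniform (hπ : IsFullDistribution n π)
    (hsum : ∑ i ∈ Finset.Icc 1 (n - k), ENNReal.ofReal (blockProb n k w i) = 1)
    {f : (Fin (n - 1) → ℝ) → ℝ≥0∞} (hf : Measurable f) :
    ∫⁻ y, blockOp n k w π f y ∂bdUniform n π = ∫⁻ y, f y ∂bdUniform n π := by
  simp only [blockOp_apply k w hπ]
  rw [bdUniform_eq_gibbs hπ 0, lintegral_finsetSum _ fun i _ =>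
    (measurable_lintegral_gibbs _ hf).const_mul _]
  rw [Finset.sum_congr rfl fun i _ => by
    rw [lintegral_const_mul _ (measurable_lintegral_gibbs _ hf),
      lintegral_lintegral_gibbs (Set.subset_univ _) 0 hf], ← Finset.sum_mul, hsum, one_mul]

theorem lintegral_iterate_blockOp_bdUniform (hπ : IsFullDistribution n π)
    (hsum : ∑ i ∈ Finset.Icc 1 (n - k), ENNReal.ofReal (blockProb n k w i) = 1)
    {f : (Fin (n - 1) → ℝ) → ℝ≥0∞} (hf : Measurable f) (t : ℕ) :
    ∫⁻ y, (blockOp n k w π)^[t] f y ∂bdUniform n π = ∫⁻ y, f y ∂bdUniform n π := by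
  induction t with
  | zero => rfl
  | succ t ih =>
    rw [← ih, Function.iterate_succ', ← lintegral_blockOp_bdUniform k w hπ hsum
      (measurable_iterate_blockOp k w hπ hf t)]
    rfl

theorem sum_blockProb {n k : ℕ} {w : ℝ} (hw : 0 < w) (hn : k + 2 ≤ n) :
    ∑ i ∈ Finset.Icc 1 (n - k), blockProb n k w i = 1 := by
  obtain ⟨m, rfl⟩ : ∃ m, n = k + (m + 2) := ⟨n - k - 2, by omega⟩
  have h1 : k + (m + 2) - k = m + 2 := by omega
  have hZ : ((k + (m + 2) : ℕ) : ℝ) - k - 2 + 2 * w = m + 2 * w := by push_cast; ring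
  have hpos : 0 < (m : ℝ) + 2 * w := by positivity
  simp only [blockProb, hZ, h1]
  rw [Finset.sum_Icc_succ_top (by omega), ← Finset.add_sum_Ioc_eq_sum_Icc (by omega),
    Finset.sum_congr rfl (g := fun _ => 1 / ((m : ℝ) + 2 * w)) fun i hi => by
      rw [Finset.mem_Ioc] at hi
      rw [if_neg (by omega)]]
  rw [if_pos (Or.inl rfl), if_pos (Or.inr rfl)]
  simp only [Finset.sum_const, Nat.card_Ioc, nsmul_eq_mul, Nat.add_sub_cancel]
  field_simp
  ring

theorem blockProb_nonneg {n k : ℕ} {w : ℝ} (hw : 0 < w) (hn : k + 2 ≤ n) (i : ℕ) :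
    0 ≤ blockProb n k w i := by
  have h1 : ((k + 2 : ℕ) : ℝ) ≤ n := by exact_mod_cast hn
  push_cast at h1
  have : 0 ≤ (n : ℝ) - k - 2 + 2 * w := by linarith
  unfold blockProb
  split_ifs <;> positivity

theorem sum_ofReal_blockProb {n k : ℕ} {w : ℝ} (hw : 0 < w) (hn : k + 2 ≤ n) :
    ∑ i ∈ Finset.Icc 1 (n - k), ENNReal.ofReal (blockProb n k w i) = 1 := by
  rw [← ENNReal.ofReal_sum_of_nonneg fun i _ => blockProb_nonneg hw hn i, sum_blockProb hw hn,
    ENNReal.ofReal_one]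

theorem isProbabilityMeasure_bdUniform (hπ : IsFullDistribution n π) :
    IsProbabilityMeasure (bdUniform n π) := by
  rw [bdUniform_eq_gibbs hπ 0]
  exact isProbabilityMeasure_gibbs (by rw [body_bdConstraints]; exact zero_mem_bdPolytope hπ)

theorem ae_mem_bdUniform (hπ : IsFullDistribution n π) :
    ∀ᵐ y ∂bdUniform n π, y ∈ bdPolytope n π :=
  ae_cond_mem (isDownSet_bdPolytope hπ).meas

/-- If all blocks shrink the influences on average, so does the transition operator. -/
theorem coordLip_blockOp (hπ : IsFullDistribution n π)
    {c' : Fin (n - 1) → ℝ} {f : (Fin (n - 1) → ℝ) → ℝ≥0∞} (D : ℕ → Fin (n - 1) → ℝ)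
    (hD : ∀ i j, 0 ≤ D i j) (hp : ∀ i, 0 ≤ blockProb n k w i)
    (h : ∀ i ∈ Finset.Icc 1 (n - k), ∀ j, ∀ x ∈ (bdConstraints n π hπ).body,
      ∀ x' ∈ (bdConstraints n π hπ).body, (∀ l ≠ j, x l = x' l) →
      Within (ENNReal.ofReal (D i j)) (∫⁻ y, f y ∂(bdConstraints n π hπ).gibbs (block n k i) x)
        (∫⁻ y, f y ∂(bdConstraints n π hπ).gibbs (block n k i) x'))
    (hc : ∀ j, ∑ i ∈ Finset.Icc 1 (n - k), blockProb n k w i * D i j ≤ c' j) :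
    (bdConstraints n π hπ).CoordLip c' (blockOp n k w π f) := by
  intro j x hx x' hx' hxx
  rw [blockOp_apply k w hπ, blockOp_apply k w hπ]
  calc _ ≤ ∑ i ∈ Finset.Icc 1 (n - k), (ENNReal.ofReal (blockProb n k w i) *
        (∫⁻ y, f y ∂(bdConstraints n π hπ).gibbs (block n k i) x') +
          ENNReal.ofReal (blockProb n k w i * D i j)) := by
        refine Finset.sum_le_sum fun i hi => ?_
        rw [ENNReal.ofReal_mul (hp i), ← mul_add]
        gcongr
        exact (h i hi j x hx x' hx' hxx).1
    _ = _ := by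
        rw [Finset.sum_add_distrib,
          ← ENNReal.ofReal_sum_of_nonneg fun i _ => mul_nonneg (hp i) (hD i j)]
    _ ≤ _ := by
        gcongr
        exact hc j

end BlockOp

/-! ### Paths of coordinates -/

/-- The coordinates to the right of `j`. -/
def rightPath {n : ℕ} (j : Fin (n - 1)) (t : ℕ) : Fin (n - 1) :=
  ⟨min (j + t) (n - 2), by omega⟩

/-- The coordinates to the left of `j`. -/
def leftPath {n : ℕ} (j : Fin (n - 1)) (t : ℕ) : Fin (n - 1) := ⟨j - t, by omega⟩

section Paths

variable {n k : ℕ} {π : ℕ → ℝ} {j : Fin (n - 1)}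

theorem inducedPath_rightPath (hπ : IsFullDistribution n π) (h : (j : ℕ) + k ≤ n - 2) :
    (bdConstraints n π hπ).InducedPath (rightPath j) k := by
  refine ⟨fun s t hs ht hst => ?_, fun s t hs ht => ?_⟩
  · rw [rightPath, rightPath, Fin.mk.injEq] at hst
    omega
  · change min ((j : ℕ) + s) (n - 2) + 1 = min (j + t) (n - 2) ∨
      min ((j : ℕ) + t) (n - 2) + 1 = min (j + s) (n - 2) ↔ _
    omega

theorem inducedPath_leftPath (hπ : IsFullDistribution n π) (h : k ≤ (j : ℕ)) :
    (bdConstraints n π hπ).InducedPath (leftPath j) k := by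
  refine ⟨fun s t hs ht hst => ?_, fun s t hs ht => ?_⟩
  · rw [leftPath, leftPath, Fin.mk.injEq] at hst
    omega
  · change (j : ℕ) - s + 1 = j - t ∨ (j : ℕ) - t + 1 = j - s ↔ _
    omega

theorem pathBlock_rightPath (h : (j : ℕ) + k ≤ n - 2) :
    pathBlock (rightPath j) k = block n k (j + 2) := by
  ext l
  constructor
  · rintro ⟨t, h1, h2, rfl⟩
    change (j : ℕ) + 2 ≤ min (j + t) (n - 2) + 1 ∧ min ((j : ℕ) + t) (n - 2) + 1 ≤ j + 2 + k - 1
    omega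
  · rintro ⟨h1, h2⟩
    exact ⟨l - j, by omega, by omega, Fin.ext (by change min ((j : ℕ) + (l - j)) (n - 2) = l; omega)⟩

theorem pathBlock_leftPath (h : k ≤ (j : ℕ)) :
    pathBlock (leftPath j) k = block n k (j + 1 - k) := by
  ext l
  constructor
  · rintro ⟨t, h1, h2, rfl⟩
    change (j : ℕ) + 1 - k ≤ j - t + 1 ∧ (j : ℕ) - t + 1 ≤ j + 1 - k + k - 1
    omega
  · rintro ⟨h1, h2⟩
    exact ⟨j - l, by omega, by omega, Fin.ext (by change (j : ℕ) - (j - l) = l; omega)⟩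

/-- The influence of the coordinate `j` when the block starting at `i` is resampled. -/
noncomputable def blockInfluence (k : ℕ) (c : Fin (n - 1) → ℝ) (i : ℕ) (j : Fin (n - 1)) : ℝ :=
  (if i ≤ (j : ℕ) + 1 ∧ (j : ℕ) + 1 ≤ i + k - 1 then 0 else c j) +
    (if i = (j : ℕ) + 2 then spread c k (rightPath j) else 0) +
    (if i + k = (j : ℕ) + 1 then spread c k (leftPath j) else 0)

theorem blockInfluence_nonneg {c : Fin (n - 1) → ℝ} (hc : ∀ j, 0 ≤ c j) (i : ℕ)
    (j : Fin (n - 1)) : 0 ≤ blockInfluence k c i j := by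
  have := hc j
  have := spread_nonneg hc k (rightPath j)
  have := spread_nonneg hc k (leftPath j)
  unfold blockInfluence
  split_ifs <;> positivity

/-- Cases by the position of `j`: inside the block it is forgotten; next to the block the path
estimate applies, running right or left from `j`; otherwise the block does not feel `j`. -/
theorem within_gibbs_block (hk : 0 < k) (hπ : IsFullDistribution n π) {c : Fin (n - 1) → ℝ}
    (hc : ∀ j, 0 ≤ c j) {f : (Fin (n - 1) → ℝ) → ℝ≥0∞} (hf : Measurable f)
    (hlip : (bdConstraints n π hπ).CoordLip c f) {i : ℕ} (hi : i ∈ Finset.Icc 1 (n - k))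
    {x x' : Fin (n - 1) → ℝ} (hx : x ∈ (bdConstraints n π hπ).body)
    (hx' : x' ∈ (bdConstraints n π hπ).body) (hxx : ∀ l ≠ j, x l = x' l) :
    Within (ENNReal.ofReal (blockInfluence k c i j))
      (∫⁻ y, f y ∂(bdConstraints n π hπ).gibbs (block n k i) x)
      (∫⁻ y, f y ∂(bdConstraints n π hπ).gibbs (block n k i) x') := by
  rw [Finset.mem_Icc] at hi
  by_cases hin : i ≤ (j : ℕ) + 1 ∧ (j : ℕ) + 1 ≤ i + k - 1
  · rw [blockInfluence, if_pos hin, if_neg (by omega), if_neg (by omega)]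
    rw [lintegral_gibbs_congr (y := x') (fun l hl => hxx l ?_) f]
    · simp [Within]
    · rintro rfl
      exact hl hin
  · by_cases hr : i = (j : ℕ) + 2
    · have hjk : (j : ℕ) + k ≤ n - 2 := by omega
      have h0 : rightPath j 0 = j := Fin.ext (by change min ((j : ℕ) + 0) (n - 2) = j; omega)
      rw [blockInfluence, if_neg hin, if_pos hr, if_neg (by omega), add_zero, hr,
        ← pathBlock_rightPath hjk]
      have := within_gibbs_pathBlock hc hf hlip k _ (inducedPath_rightPath hπ hjk) x hx x' hx'
        (by rwa [h0])
      rwa [h0] at this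
    · by_cases hl : i + k = (j : ℕ) + 1
      · have hjk : k ≤ (j : ℕ) := by omega
        have h0 : leftPath j 0 = j := Fin.ext (by change (j : ℕ) - 0 = j; omega)
        rw [blockInfluence, if_neg hin, if_neg hr, if_pos hl, add_zero,
          show i = (j : ℕ) + 1 - k by omega, ← pathBlock_leftPath hjk]
        have := within_gibbs_pathBlock hc hf hlip k _ (inducedPath_leftPath hπ hjk) x hx x' hx'
          (by rwa [h0])
        rwa [h0] at this
      · rw [blockInfluence, if_neg hin, if_neg hr, if_neg hl, add_zero, add_zero]
        refine within_gibbs_of_not_adj (i := j) hin (fun l hlb => ?_) hx hx' hxx hf hlip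
        obtain ⟨h1, h2⟩ := hlb
        change ¬ ((j : ℕ) + 1 = l ∨ (l : ℕ) + 1 = j)
        omega

end Paths

/-! ### Bounds on the spread of discrepancies -/

theorem spread_add {ι : Type} (c d : ι → ℝ) :
    ∀ (k : ℕ) (e : ℕ → ι), spread (fun i => c i + d i) k e = spread c k e + spread d k e
  | 0, _ => by simp [spread]
  | 1, e => rfl
  | k + 2, e => by
    rw [spread, spread, spread, spread_add c d k]
    ring

/-- `3 h` is the fixed point of the recursion `S = h + (h + S) / 2`. -/
theorem spread_const_le {ι : Type} {h : ℝ} (h0 : 0 ≤ h) :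
    ∀ (k : ℕ) (e : ℕ → ι), spread (fun _ => h) k e ≤ 3 * h
  | 0, _ => by simpa [spread] using h0
  | 1, e => by
    rw [spread]
    linarith
  | k + 2, e => by
    have := spread_const_le h0 k fun t => e (t + 2)
    rw [spread]
    linarith

theorem spread_single_eq_zero {ι : Type} [DecidableEq ι] (h : ℝ) (s : ι) :
    ∀ (k : ℕ) (e : ℕ → ι), (∀ t, 1 ≤ t → t ≤ k → e t ≠ s) →
      spread (fun i => if i = s then h else 0) k e = 0
  | 0, _, _ => rfl
  | 1, e, he => if_neg (he 1 le_rfl le_rfl)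
  | k + 2, e, he => by
    rw [spread, spread_single_eq_zero h s k _ fun t h1 h2 => he (t + 2) (by omega) (by omega),
      if_neg (he 1 le_rfl (by omega)), if_neg (he 2 (by omega) (by omega))]
    simp

/-- An injective path meets `s` at most once, and a factor `1/2` is gained as soon as `s` is not its
first site. -/
theorem spread_single_le {ι : Type} [DecidableEq ι] {h : ℝ} (h0 : 0 ≤ h) (s : ι) :
    ∀ (k : ℕ) (e : ℕ → ι),
      (∀ t t', 1 ≤ t → t ≤ k → 1 ≤ t' → t' ≤ k → e t = e t' → t = t') →
      spread (fun i => if i = s then h else 0) k e ≤ h ∧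
        (e 1 ≠ s → spread (fun i => if i = s then h else 0) k e ≤ h / 2)
  | 0, _, _ => ⟨h0, fun _ => by rw [spread]; positivity⟩
  | 1, e, _ => by
    rw [spread]
    split_ifs with h1
    · exact ⟨le_rfl, fun h => absurd h1 h⟩
    · exact ⟨h0, fun _ => by positivity⟩
  | k + 2, e, he => by
    have ih := (spread_single_le h0 s k (fun t => e (t + 2)) fun t t' h1 h2 h3 h4 htt => by
      have := he (t + 2) (t' + 2) (by omega) (by omega) (by omega) (by omega) htt
      omega).1
    rw [spread]
    by_cases h1 : e 1 = s
    · have h2 : e 2 ≠ s := fun h2 => by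
        have := he 1 2 le_rfl (by omega) (by omega) (by omega) (h1.trans h2.symm)
        omega
      rw [if_pos h1, if_neg h2, spread_single_eq_zero h s k]
      · exact ⟨by linarith, fun h => absurd h1 h⟩
      · intro t ht1 ht2 ht
        have := he 1 (t + 2) le_rfl (by omega) (by omega) (by omega) (h1.trans ht.symm)
        omega
    · rw [if_neg h1]
      by_cases h2 : e 2 = s
      · rw [if_pos h2, spread_single_eq_zero h s k]
        · constructor <;> intros <;> linarith
        · intro t ht1 ht2 ht
          have := he 2 (t + 2) (by omega) (by omega) (by omega) (by omega) (h2.trans ht.symm)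
          omega
      · rw [if_neg h2]
        constructor <;> intros <;> linarith

/-! ### Contraction of the sampler with blocks of length `55` -/

/-- The bound for the contribution to the spread of a coordinate with additional weight `9`. -/
noncomputable def extraSpread {n : ℕ} (e : ℕ → Fin (n - 1)) (s : ℕ) : ℝ :=
  spread (fun i : Fin (n - 1) => if (i : ℕ) = s then 9 else 0) 55 e

/-- The weight of a coordinate; the two coordinates next to the blocks at the ends, which are
chosen with high probability, have an additional weight. -/
noncomputable def coordWeight (n : ℕ) (j : Fin (n - 1)) : ℝ :=
  1 + (if (j : ℕ) = 55 then 9 else 0) + (if (j : ℕ) = n - 57 then 9 else 0)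

theorem spread_smul {ι : Type} (L : ℝ) (c : ι → ℝ) :
    ∀ (k : ℕ) (e : ℕ → ι), spread (fun i => L * c i) k e = L * spread c k e
  | 0, _ => by simp [spread]
  | 1, e => rfl
  | k + 2, e => by
    rw [spread, spread, spread_smul L c k]
    ring

theorem spread_coordWeight_le {n : ℕ} (e : ℕ → Fin (n - 1)) :
    spread (coordWeight n) 55 e ≤ 3 + extraSpread e 55 + extraSpread e (n - 57) := by
  have h1 := spread_const_le (ι := Fin (n - 1)) (h := 1) zero_le_one 55 e
  have h2 := spread_add (fun _ : Fin (n - 1) => (1 : ℝ))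
    (fun j => if (j : ℕ) = 55 then 9 else 0) 55 e
  have h3 := spread_add (fun j : Fin (n - 1) => 1 + if (j : ℕ) = 55 then (9 : ℝ) else 0)
    (fun j => if (j : ℕ) = n - 57 then 9 else 0) 55 e
  rw [h2] at h3
  change spread (fun j : Fin (n - 1) => 1 + (if (j : ℕ) = 55 then (9 : ℝ) else 0) +
    if (j : ℕ) = n - 57 then 9 else 0) 55 e ≤ _
  rw [h3]
  unfold extraSpread
  linarith

theorem extraSpread_of_lt {n s : ℕ} (e : ℕ → Fin (n - 1)) (hs : s < n - 1) :
    extraSpread e s =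
      spread (fun i => if i = (⟨s, hs⟩ : Fin (n - 1)) then 9 else 0) 55 e := by
  unfold extraSpread
  congr 1
  funext i
  simp [Fin.ext_iff]

theorem extraSpread_bounds {n s : ℕ} (e : ℕ → Fin (n - 1)) (hs : s < n - 1)
    (he : ∀ t t', 1 ≤ t → t ≤ 55 → 1 ≤ t' → t' ≤ 55 → e t = e t' → t = t') :
    extraSpread e s ≤ 9 ∧ ((e 1 : ℕ) ≠ s → extraSpread e s ≤ 9 / 2) ∧
      ((∀ t, 1 ≤ t → t ≤ 55 → (e t : ℕ) ≠ s) → extraSpread e s = 0) := by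
  rw [extraSpread_of_lt e hs]
  have := spread_single_le (h := 9) (by norm_num) (⟨s, hs⟩ : Fin (n - 1)) 55 e he
  refine ⟨this.1, fun h => this.2 fun h' => h (by rw [h']), fun h => ?_⟩
  exact spread_single_eq_zero _ _ _ _ fun t h1 h2 h' => h t h1 h2 (congrArg Fin.val h')

theorem blockProb_eq {n : ℕ} (i : ℕ) :
    blockProb n 55 55 i = (if i = 1 ∨ i = n - 55 then 55 else 1) / ((n : ℝ) + 53) := by
  have : (n : ℝ) - (55 : ℕ) - 2 + 2 * 55 = n + 53 := by push_cast; ring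
  rw [blockProb, this]
  split_ifs <;> rfl

/-- The total weight of the blocks containing the coordinate `q`. -/
noncomputable def coverWeight (n q : ℕ) : ℝ :=
  ∑ i ∈ Finset.Icc 1 (n - 55) with i ≤ q ∧ q ≤ i + 55 - 1, if i = 1 ∨ i = n - 55 then 55 else 1

/-- A coordinate among the first or last `55` lies in an end block, of weight `55`; any other lies
in `55` blocks of weight at least `1`. -/
theorem le_coverWeight {n q : ℕ} (hn : 58 < n) (hq : 1 ≤ q) (hqn : q ≤ n - 1) :
    55 ≤ coverWeight n q := by
  have h0 : ∀ i ∈ (Finset.Icc 1 (n - 55)).filter fun i => i ≤ q ∧ q ≤ i + 55 - 1,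
      (0 : ℝ) ≤ if i = 1 ∨ i = n - 55 then 55 else 1 := fun i _ => by split_ifs <;> norm_num
  by_cases h1 : q ≤ 55
  · have := Finset.single_le_sum h0 (a := 1)
      (Finset.mem_filter.2 ⟨Finset.mem_Icc.2 (by omega), by omega⟩)
    simpa [coverWeight] using this
  · by_cases h2 : n - 55 ≤ q
    · have := Finset.single_le_sum h0 (a := n - 55)
        (Finset.mem_filter.2 ⟨Finset.mem_Icc.2 (by omega), by omega⟩)
      simpa [coverWeight] using this
    · calc (55 : ℝ) = ∑ _i ∈ Finset.Icc (q - 54) q, (1 : ℝ) := by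
            rw [Finset.sum_const, Nat.card_Icc, show q + 1 - (q - 54) = 55 by omega]
            norm_num
        _ ≤ ∑ i ∈ Finset.Icc (q - 54) q, if i = 1 ∨ i = n - 55 then 55 else 1 :=
            Finset.sum_le_sum fun i _ => by split_ifs <;> norm_num
        _ ≤ coverWeight n q := by
            refine Finset.sum_le_sum_of_subset_of_nonneg (fun i hi => ?_) fun i hi _ => h0 i hi
            rw [Finset.mem_Icc] at hi
            exact Finset.mem_filter.2 ⟨Finset.mem_Icc.2 (by omega), by omega⟩

/-- For `n = 111` the end blocks tile the `110` coordinates and `55`, `56` are the sites where they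
meet. Each lies in one end block and in `54` others: `55 + 54 = 109`. This compensates for a heavy
coordinate being the first site reached from the other. -/
theorem le_coverWeight_of_eq {n q : ℕ} (hn : n = 111) (hq : q = 55 ∨ q = 56) :
    109 ≤ coverWeight n q := by
  subst hn
  have key : ∀ a h : ℕ, a ≤ h → h ≤ a + 54 → (h = 1 ∨ h = 56) →
      Finset.Icc a (a + 54) = (Finset.Icc 1 (111 - 55)).filter (fun i => i ≤ q ∧ q ≤ i + 55 - 1) →
      109 ≤ coverWeight 111 q := by
    intro a h h1 h2 h3 h4
    rw [coverWeight, ← h4]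
    calc (109 : ℝ) = ∑ i ∈ Finset.Icc a (a + 54), (1 + if i = h then 54 else 0) := by
          rw [Finset.sum_add_distrib, Finset.sum_ite_eq', if_pos (Finset.mem_Icc.2 ⟨h1, h2⟩),
            Finset.sum_const, Nat.card_Icc, show a + 54 + 1 - a = 55 by omega]
          norm_num
      _ ≤ _ := Finset.sum_le_sum fun i _ => by
          by_cases hi : i = h
          · rw [if_pos hi, if_pos (by omega)]
            norm_num
          · rw [if_neg hi]
            split_ifs <;> norm_num
  rcases hq with rfl | rfl
  · refine key 1 1 (by omega) (by omega) (by omega) ?_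
    ext i
    simp only [Finset.mem_filter, Finset.mem_Icc]
    omega
  · refine key 2 56 (by omega) (by omega) (by omega) ?_
    ext i
    simp only [Finset.mem_filter, Finset.mem_Icc]
    omega

theorem coordWeight_pos {n : ℕ} (j : Fin (n - 1)) : 1 ≤ coordWeight n j := by
  unfold coordWeight
  split_ifs <;> norm_num

/-- The mean influence is the old weight plus a drift: gains from the at most two blocks adjacent to
`j`, minus the loss from the blocks containing it. -/
theorem sum_blockProb_mul_blockInfluence {n : ℕ} (hn : 58 < n) (j : Fin (n - 1)) :
    ∑ i ∈ Finset.Icc 1 (n - 55), blockProb n 55 55 i * blockInfluence 55 (coordWeight n) i j =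
      coordWeight n j + ((if (j : ℕ) + 57 ≤ n then
          (if (j : ℕ) + 57 = n then 55 else 1) * spread (coordWeight n) 55 (rightPath j) else 0) +
        (if 55 ≤ (j : ℕ) then
          (if (j : ℕ) = 55 then 55 else 1) * spread (coordWeight n) 55 (leftPath j) else 0) -
        coverWeight n (j + 1) * coordWeight n j) / (n + 53) := by
  have hj := j.2
  have hZ : (0 : ℝ) < n + 53 := by positivity
  have hsum := sum_blockProb (n := n) (k := 55) (w := 55) (by norm_num) (by omega)
  have h1 : ∑ i ∈ Finset.Icc 1 (n - 55), blockProb n 55 55 i *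
      (if i ≤ (j : ℕ) + 1 ∧ (j : ℕ) + 1 ≤ i + 55 - 1 then 0 else coordWeight n j) =
      coordWeight n j - coverWeight n (j + 1) * coordWeight n j / (n + 53) := by
    rw [eq_sub_iff_add_eq]
    rw [coverWeight, Finset.sum_filter, Finset.sum_mul, Finset.sum_div, ← Finset.sum_add_distrib]
    conv_rhs => rw [← one_mul (coordWeight n j), ← hsum, Finset.sum_mul]
    refine Finset.sum_congr rfl fun i _ => ?_
    rw [blockProb_eq]
    split_ifs <;> ring
  have h2 : ∑ i ∈ Finset.Icc 1 (n - 55), blockProb n 55 55 i *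
      (if i = (j : ℕ) + 2 then spread (coordWeight n) 55 (rightPath j) else 0) =
      (if (j : ℕ) + 57 ≤ n then
        (if (j : ℕ) + 57 = n then 55 else 1) * spread (coordWeight n) 55 (rightPath j) else 0) /
        (n + 53) := by
    simp only [mul_ite, mul_zero, Finset.sum_ite_eq', Finset.mem_Icc]
    by_cases h : (j : ℕ) + 57 ≤ n
    · rw [if_pos (by omega), if_pos h, blockProb_eq]
      by_cases h' : (j : ℕ) + 57 = n
      · rw [if_pos (by omega), if_pos h']; ring
      · rw [if_neg (by omega), if_neg h']; ring
    · rw [if_neg (by omega), if_neg h, zero_div]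
  have h3 : ∑ i ∈ Finset.Icc 1 (n - 55), blockProb n 55 55 i *
      (if i + 55 = (j : ℕ) + 1 then spread (coordWeight n) 55 (leftPath j) else 0) =
      (if 55 ≤ (j : ℕ) then
        (if (j : ℕ) = 55 then 55 else 1) * spread (coordWeight n) 55 (leftPath j) else 0) /
        (n + 53) := by
    by_cases h : 55 ≤ (j : ℕ)
    · have : ∀ i, i + 55 = (j : ℕ) + 1 ↔ i = j - 54 := fun i => by omega
      simp only [this, mul_ite, mul_zero, Finset.sum_ite_eq', Finset.mem_Icc]
      rw [if_pos (by omega), if_pos h, blockProb_eq]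
      by_cases h' : (j : ℕ) = 55
      · rw [if_pos (by omega), if_pos h']; ring
      · rw [if_neg (by omega), if_neg h']; ring
    · rw [if_neg h, zero_div]
      refine Finset.sum_eq_zero fun i hi => ?_
      rw [Finset.mem_Icc] at hi
      rw [if_neg (by omega), mul_zero]
  unfold blockInfluence
  simp only [mul_add, Finset.sum_add_distrib]
  rw [h1, h2, h3]
  ring

/-- An ordinary coordinate spreads at most `3 + 9 + 9 = 21` to each side, and `21 + 21 + 12 = 54 <
55`. A heavy coordinate has weight `10`, hence loss at least `550`. If the opposite block exists,
the total is at most `55 * 3 + 21 + 120`. Otherwise the other heavy coordinate lies inside the end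
block, giving `55 * (3 + 9 / 2) + 120`, unless it is the first site, where `n = 111` and the loss is
`1090`. For `n = 112` the heavy coordinates coincide, with weight `19`. -/
theorem weighted_spread_le {n : ℕ} (hn : 58 < n) (j : Fin (n - 1)) :
    (if (j : ℕ) + 57 ≤ n then
        (if (j : ℕ) + 57 = n then 55 else 1) * spread (coordWeight n) 55 (rightPath j) else 0) +
      (if 55 ≤ (j : ℕ) then
        (if (j : ℕ) = 55 then 55 else 1) * spread (coordWeight n) 55 (leftPath j) else 0) +
      12 * coordWeight n j ≤ coverWeight n (j + 1) * coordWeight n j := by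
  have hj := j.2
  have hcov := le_coverWeight hn (q := j + 1) (by omega) (by omega)
  have hvR : ∀ t, (rightPath j t : ℕ) = min ((j : ℕ) + t) (n - 2) := fun t => rfl
  have hvL : ∀ t, (leftPath j t : ℕ) = (j : ℕ) - t := fun t => rfl
  have hR := spread_coordWeight_le (rightPath j)
  have hL := spread_coordWeight_le (leftPath j)
  have hRb : ∀ s < n - 1, (j : ℕ) + 57 ≤ n → _ := fun s hs h =>
    extraSpread_bounds (rightPath j) hs fun t t' h1 h2 h3 h4 htt => by
      have := congrArg Fin.val htt
      rw [hvR, hvR] at this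
      omega
  have hLb : ∀ s < n - 1, 55 ≤ (j : ℕ) → _ := fun s hs h =>
    extraSpread_bounds (leftPath j) hs fun t t' h1 h2 h3 h4 htt => by
      have := congrArg Fin.val htt
      rw [hvL, hvL] at this
      omega
  have hw : coordWeight n j =
    1 + (if (j : ℕ) = 55 then 9 else 0) + (if (j : ℕ) = n - 57 then 9 else 0) := rfl
  by_cases c1 : (j : ℕ) = 55 <;> by_cases c2 : (j : ℕ) + 57 = n
  · have e1 := (hRb 55 (by omega) (by omega)).2.2 fun t h1 h2 => by rw [hvR]; omega
    have e2 := (hRb (n - 57) (by omega) (by omega)).2.2 fun t h1 h2 => by rw [hvR]; omega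
    have e3 := (hLb 55 (by omega) (by omega)).2.2 fun t h1 h2 => by rw [hvL]; omega
    have e4 := (hLb (n - 57) (by omega) (by omega)).2.2 fun t h1 h2 => by rw [hvL]; omega
    rw [if_pos (show (j : ℕ) + 57 ≤ n by omega), if_pos (show 55 ≤ (j : ℕ) by omega), if_pos c2,
      hw, if_pos c1, if_pos c1, if_pos (show (j : ℕ) = n - 57 by omega)]
    linarith
  · have e3 := (hLb 55 (by omega) (by omega)).2.2 fun t h1 h2 => by rw [hvL]; omega
    have e4 := hLb (n - 57) (by omega) (by omega)
    rw [if_pos (show 55 ≤ (j : ℕ) by omega), if_neg c2, if_pos c1, hw, if_pos c1,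
      if_neg (show (j : ℕ) ≠ n - 57 by omega)]
    by_cases c3 : (j : ℕ) + 57 ≤ n
    · have e1 := (hRb 55 (by omega) c3).1
      have e2 := (hRb (n - 57) (by omega) c3).1
      have e5 := e4.2.2 fun t h1 h2 => by rw [hvL]; omega
      rw [if_pos c3]
      linarith
    · rw [if_neg c3]
      by_cases c4 : n = 111
      · have h5 := le_coverWeight_of_eq c4 (q := j + 1) (by omega)
        have := e4.1
        linarith
      · have := e4.2.1 (by rw [hvL]; omega)
        linarith
  · have e1 := (hRb (n - 57) (by omega) (by omega)).2.2 fun t h1 h2 => by rw [hvR]; omega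
    have e4 := hRb 55 (by omega) (by omega)
    rw [if_pos (show (j : ℕ) + 57 ≤ n by omega), if_pos c2, if_neg c1, hw, if_neg c1,
      if_pos (show (j : ℕ) = n - 57 by omega)]
    by_cases c3 : 55 ≤ (j : ℕ)
    · have e2 := (hLb 55 (by omega) c3).1
      have e3 := (hLb (n - 57) (by omega) c3).1
      have e5 := e4.2.2 fun t h1 h2 => by rw [hvR]; omega
      rw [if_pos c3]
      linarith
    · rw [if_neg c3]
      by_cases c4 : n = 111
      · have h5 := le_coverWeight_of_eq c4 (q := j + 1) (by omega)
        have := e4.1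
        linarith
      · have := e4.2.1 (by rw [hvR]; omega)
        linarith
  · rw [if_neg c2, if_neg c1, hw, if_neg c1, if_neg (show (j : ℕ) ≠ n - 57 by omega), one_mul, one_mul]
    have hr : (if (j : ℕ) + 57 ≤ n then spread (coordWeight n) 55 (rightPath j) else 0) ≤ 21 := by
      split_ifs with h
      · have := (hRb 55 (by omega) h).1
        have := (hRb (n - 57) (by omega) h).1
        linarith
      · norm_num
    have hl : (if 55 ≤ (j : ℕ) then spread (coordWeight n) 55 (leftPath j) else 0) ≤ 21 := by
      split_ifs with h
      · have := (hLb 55 (by omega) h).1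
        have := (hLb (n - 57) (by omega) h).1
        linarith
      · norm_num
    linarith

theorem coordLip_blockOp_coordWeight {n : ℕ} {π : ℕ → ℝ} (hn : 58 < n)
    (hπ : IsFullDistribution n π) {L : ℝ} (hL : 0 ≤ L) {f : (Fin (n - 1) → ℝ) → ℝ≥0∞}
    (hf : Measurable f) (hlip : (bdConstraints n π hπ).CoordLip (fun j => L * coordWeight n j) f) :
    (bdConstraints n π hπ).CoordLip (fun j => L * (1 - 12 / (n + 53)) * coordWeight n j)
      (blockOp n 55 55 π f) := by
  have hc0 : ∀ j, 0 ≤ L * coordWeight n j :=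
    fun j => mul_nonneg hL (zero_le_one.trans (coordWeight_pos j))
  refine coordLip_blockOp 55 55 hπ (blockInfluence 55 fun j => L * coordWeight n j)
    (blockInfluence_nonneg hc0) (blockProb_nonneg (by norm_num) (by omega))
    (fun i hi j x hx x' hx' hxx => within_gibbs_block (by norm_num) hπ hc0 hf hlip hi hx hx' hxx)
    fun j => ?_
  have hsc : ∀ i, blockInfluence 55 (fun j => L * coordWeight n j) i j =
      L * blockInfluence 55 (coordWeight n) i j := by
    intro i
    unfold blockInfluence
    rw [spread_smul, spread_smul]
    split_ifs <;> ring
  simp only [hsc, mul_left_comm _ L]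
  rw [← Finset.mul_sum, sum_blockProb_mul_blockInfluence hn, mul_assoc L]
  refine mul_le_mul_of_nonneg_left ?_ hL
  have hZ : (0 : ℝ) < n + 53 := by positivity
  have h1 := weighted_spread_le hn j
  have h2 : (1 - 12 / ((n : ℝ) + 53)) * coordWeight n j =
      coordWeight n j + (-(12 * coordWeight n j)) / (n + 53) := by ring
  rw [h2]
  gcongr
  linarith

theorem coordLip_iterate_blockOp {n : ℕ} {π : ℕ → ℝ} (hn : 58 < n)
    (hπ : IsFullDistribution n π) {f : (Fin (n - 1) → ℝ) → ℝ≥0∞} (hf : Measurable f)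
    (hf1 : ∀ x, f x ≤ 1) (t : ℕ) :
    (bdConstraints n π hπ).CoordLip (fun j => (1 - 12 / ((n : ℝ) + 53)) ^ t * coordWeight n j)
      ((blockOp n 55 55 π)^[t] f) := by
  have hn' : (58 : ℝ) < n := by exact_mod_cast hn
  induction t with
  | zero =>
    intro j x _ x' _ _
    refine (hf1 x).trans (le_add_of_nonneg_of_le zero_le ?_)
    rw [ENNReal.one_le_ofReal, pow_zero]
    simp only [one_mul]
    exact coordWeight_pos j
  | succ t ih =>
    rw [Function.iterate_succ_apply', pow_succ]
    refine coordLip_blockOp_coordWeight hn hπ (pow_nonneg ?_ t)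
      (measurable_iterate_blockOp 55 55 hπ hf t) ih
    rw [sub_nonneg, div_le_one (by positivity)]
    linarith

theorem sum_coordWeight_le {n : ℕ} (hn : 58 < n) : ∑ j, coordWeight n j ≤ (n : ℝ) + 17 := by
  have h : ∀ s, s < n - 1 →
      ∑ j : Fin (n - 1), (if (j : ℕ) = s then (9 : ℝ) else 0) = 9 := by
    intro s hs
    rw [Finset.sum_eq_single (⟨s, hs⟩ : Fin (n - 1))]
    · simp
    · intro j _ hj
      rw [if_neg fun h => hj (Fin.ext h)]
    · simp
  unfold coordWeight
  rw [Finset.sum_add_distrib, Finset.sum_add_distrib, h 55 (by omega), h (n - 57) (by omega)]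
  simp only [Finset.sum_const, Finset.card_univ, Fintype.card_fin, nsmul_eq_mul, mul_one]
  rw [Nat.cast_sub (by omega)]
  push_cast
  linarith

/-! ### Total variation estimates and the upper bound -/

theorem Within.abs_toReal_sub_le {u v : ℝ≥0∞} {d : ℝ} (h : Within (ENNReal.ofReal d) u v)
    (hd : 0 ≤ d) (hu : u ≠ ∞) (hv : v ≠ ∞) : |u.toReal - v.toReal| ≤ d := by
  have key : ∀ {u v : ℝ≥0∞}, v ≠ ∞ → u ≤ v + ENNReal.ofReal d → u.toReal ≤ v.toReal + d := by
    intro u v hv h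
    have := ENNReal.toReal_mono (ENNReal.add_ne_top.2 ⟨hv, ENNReal.ofReal_ne_top⟩) h
    rwa [ENNReal.toReal_add hv ENNReal.ofReal_ne_top, ENNReal.toReal_ofReal hd] at this
  have h1 := key hv h.1
  have h2 := key hu h.2
  rw [abs_le]
  constructor <;> linarith

section Law

variable {n k : ℕ} {w : ℝ} {π : ℕ → ℝ}

theorem blockStep_univ_le_one (hw : 0 < w) (hn : k + 2 ≤ n) (hπ : IsFullDistribution n π)
    (x : Fin (n - 1) → ℝ) : blockStep n k w π x Set.univ ≤ 1 := by
  rw [blockStep, Measure.finsetSum_apply]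
  calc _ ≤ ∑ i ∈ Finset.Icc 1 (n - k), ENNReal.ofReal (blockProb n k w i) := by
        refine Finset.sum_le_sum fun i _ => ?_
        rw [Measure.smul_apply, smul_eq_mul]
        exact mul_le_of_le_one_right' (uniformMeasure_univ_le_one (isDownSet_bdPolytope hπ) _ _)
    _ = 1 := sum_ofReal_blockProb hw hn

theorem blockLaw_univ_le_one (hw : 0 < w) (hn : k + 2 ≤ n) (hπ : IsFullDistribution n π)
    (x : Fin (n - 1) → ℝ) (t : ℕ) : blockLaw n k w π x t Set.univ ≤ 1 := by
  induction t with
  | zero => simp [blockLaw]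
  | succ t ih =>
    rw [blockLaw, Measure.bind_apply MeasurableSet.univ (measurable_blockStep k w hπ).aemeasurable]
    calc _ ≤ ∫⁻ _, 1 ∂blockLaw n k w π x t :=
          lintegral_mono fun y => blockStep_univ_le_one hw hn hπ y
      _ ≤ 1 := by rwa [lintegral_one]

theorem abs_real_sub_le_one {Ω : Type} [MeasurableSpace Ω] {μ ν : Measure Ω}
    (hμ : μ Set.univ ≤ 1) (hν : ν Set.univ ≤ 1) (A : Set Ω) : |μ.real A - ν.real A| ≤ 1 := by
  have key : ∀ {μ : Measure Ω}, μ Set.univ ≤ 1 → μ.real A ≤ 1 := fun h => by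
    have := ENNReal.toReal_mono ENNReal.one_ne_top ((measure_mono (Set.subset_univ A)).trans h)
    simpa [Measure.real] using this
  have h1 := key hμ
  have h2 := key hν
  have h3 : 0 ≤ μ.real A := measureReal_nonneg
  have h4 : 0 ≤ ν.real A := measureReal_nonneg
  rw [abs_le]
  constructor <;> linarith

theorem tvDist_le {Ω : Type} [MeasurableSpace Ω] {μ ν : Measure Ω} {d : ℝ}
    (h : ∀ A, MeasurableSet A → |μ.real A - ν.real A| ≤ d) : tvDist μ ν ≤ d := by
  have : Nonempty {A : Set Ω // MeasurableSet A} := ⟨⟨∅, MeasurableSet.empty⟩⟩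
  exact ciSup_le fun A => h A.1 A.2

end Law

/-- By stationarity `U_π A` is the `U_π`-average of the iterated indicator of `A`. Its values differ
from the one at `x` by at most twice the sum of the contracted weights. -/
theorem tvDist_blockLaw_le {n : ℕ} {π : ℕ → ℝ} (hn : 58 < n) (hπ : IsFullDistribution n π)
    {x : Fin (n - 1) → ℝ} (hx : x ∈ bdPolytope n π) (t : ℕ) :
    tvDist (blockLaw n 55 55 π x t) (bdUniform n π) ≤
      2 * (n + 17) * (1 - 12 / ((n : ℝ) + 53)) ^ t := by
  have hn' : (58 : ℝ) < n := by exact_mod_cast hn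
  have hδ : 0 ≤ 1 - 12 / ((n : ℝ) + 53) := by
    rw [sub_nonneg, div_le_one (by positivity)]
    linarith
  have := isProbabilityMeasure_bdUniform hπ
  have hc0 : ∀ j, 0 ≤ (1 - 12 / ((n : ℝ) + 53)) ^ t * coordWeight n j :=
    fun j => mul_nonneg (pow_nonneg hδ t) (zero_le_one.trans (coordWeight_pos j))
  refine tvDist_le fun A hA => ?_
  have hAm : Measurable (A.indicator (1 : (Fin (n - 1) → ℝ) → ℝ≥0∞)) := measurable_one.indicator hA
  have hlip := coordLip_iterate_blockOp hn hπ hAm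
    (fun x => Set.indicator_le_self' (fun _ _ => zero_le) x) t
  have hw : Within (ENNReal.ofReal (2 * ∑ j, (1 - 12 / ((n : ℝ) + 53)) ^ t * coordWeight n j))
      (blockLaw n 55 55 π x t A) (bdUniform n π A) := by
    rw [← lintegral_indicator_one hA, ← lintegral_indicator_one hA,
      ← lintegral_iterate_blockOp_bdUniform 55 55 hπ
        (sum_ofReal_blockProb (by norm_num) (by omega)) hAm t, lintegral_blockLaw 55 55 hπ x t hAm]
    have hconst : (blockOp n 55 55 π)^[t] (A.indicator 1) x =
        ∫⁻ _, (blockOp n 55 55 π)^[t] (A.indicator 1) x ∂bdUniform n π := by simp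
    rw [hconst]
    refine within_lintegral measure_univ ((ae_mem_bdUniform hπ).mono fun y hy => ?_)
    rw [← body_bdConstraints hπ] at hx hy
    exact hlip.within_sum hc0 hx hy
  have h1 : blockLaw n 55 55 π x t A ≠ ∞ := ne_top_of_le_ne_top ENNReal.one_ne_top
    ((measure_mono (Set.subset_univ A)).trans
      (blockLaw_univ_le_one (by norm_num) (by omega) hπ x t))
  refine (hw.abs_toReal_sub_le (mul_nonneg zero_le_two (Finset.sum_nonneg fun j _ => hc0 j)) h1
    (measure_ne_top _ _)).trans ?_
  rw [← Finset.mul_sum]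
  have h2 := mul_le_mul_of_nonneg_left (sum_coordWeight_le hn) (pow_nonneg hδ t)
  linarith

/-- Rapid mixing of the block Gibbs sampler with blocks of length `55`. -/
theorem tvDist_blockLaw_le_rpow {n : ℕ} {π : ℕ → ℝ} {x : Fin (n - 1) → ℝ} {c : ℝ} {t : ℕ}
    (hn : 58 < n) (hπ : IsFullDistribution n π) (hx : x ∈ bdPolytope n π)
    (ht : 2 * c * n * Real.log n < t) :
    tvDist (blockLaw n 55 55 π x t) (bdUniform n π) ≤ (n : ℝ) ^ (1 - c) := by
  have hn' : (58 : ℝ) < n := by exact_mod_cast hn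
  have hn0 : (0 : ℝ) < n := by linarith
  have := isProbabilityMeasure_bdUniform hπ
  -- For `c < 1` the claimed bound is at least `1`.
  rcases lt_or_ge c 1 with hc1 | hc1
  · refine le_trans ?_ (Real.one_le_rpow (by linarith) (by linarith))
    exact tvDist_le fun A _ => abs_real_sub_le_one
      (blockLaw_univ_le_one (by norm_num) (by omega) hπ x t) prob_le_one A
  · have hlog : 0 < Real.log n := Real.log_pos (by linarith)
    have hZ : (0 : ℝ) < n + 53 := by positivity
    refine (tvDist_blockLaw_le hn hπ hx t).trans ?_
    have h1 : (1 - 12 / ((n : ℝ) + 53)) ^ t ≤ (n : ℝ) ^ (-(12 * c)) := by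
      calc (1 - 12 / ((n : ℝ) + 53)) ^ t ≤ (Real.exp (-(12 / ((n : ℝ) + 53)))) ^ t := by
            refine pow_le_pow_left₀ ?_ (Real.one_sub_le_exp_neg _) t
            rw [sub_nonneg, div_le_one hZ]
            linarith
        _ = Real.exp (t * -(12 / ((n : ℝ) + 53))) := (Real.exp_nat_mul _ t).symm
        _ ≤ Real.exp (Real.log n * -(12 * c)) := by
            refine Real.exp_le_exp.2 ?_
            -- Uses `n + 53 ≤ 2 * n`.
            have h2 : 12 * c * Real.log n ≤ t * (12 / ((n : ℝ) + 53)) := by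
              rw [← mul_div_assoc, le_div_iff₀ hZ]
              have h3 : 0 < c * Real.log n := by positivity
              nlinarith
            linarith
        _ = (n : ℝ) ^ (-(12 * c)) := by rw [Real.rpow_def_of_pos hn0]
    -- Here `2 * (n + 17) ≤ n ^ 2`, and `2 - 12 * c ≤ 1 - c` because `c ≥ 1`.
    calc 2 * ((n : ℝ) + 17) * (1 - 12 / ((n : ℝ) + 53)) ^ t
        ≤ (n : ℝ) ^ (2 : ℝ) * (n : ℝ) ^ (-(12 * c)) := by
          refine mul_le_mul ?_ h1 (pow_nonneg ?_ t) (by positivity)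
          · rw [Real.rpow_two]
            nlinarith
          · rw [sub_nonneg, div_le_one hZ]
            linarith
      _ = (n : ℝ) ^ (2 + -(12 * c)) := (Real.rpow_add hn0 _ _).symm
      _ ≤ (n : ℝ) ^ (1 - c) := Real.rpow_le_rpow_of_exponent_le (by linarith) (by linarith)

/-! ### Coordinates which have not been resampled -/

/-- The left side consists of the first two terms of the binomial expansion. -/
theorem pow_succ_add_mul_le_add_pow {s d : ℝ} (hs : 0 ≤ s) (hd : 0 ≤ d) (m : ℕ) :
    s ^ (m + 1) + (m + 1) * d * s ^ m ≤ (s + d) ^ (m + 1) := by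
  induction m with
  | zero => simp
  | succ m ih =>
    have h1 : 0 ≤ ((m : ℝ) + 1) * d * s ^ m * d := by positivity
    calc _ ≤ (s ^ (m + 1) + (m + 1) * d * s ^ m) * (s + d) := by
          push_cast
          have : (s ^ (m + 1) + (m + 1) * d * s ^ m) * (s + d) =
            s ^ (m + 1 + 1) + ((m : ℝ) + 1 + 1) * d * s ^ (m + 1) +
              ((m : ℝ) + 1) * d * s ^ m * d := by ring
          linarith
      _ ≤ (s + d) ^ (m + 1) * (s + d) := by gcongr
      _ = _ := (pow_succ _ _).symm

/-- The coordinate `j` belongs to the block of length `k` starting at `i`. -/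
def InBlock {n : ℕ} (k i : ℕ) (j : Fin (n - 1)) : Prop :=
  i ≤ (j : ℕ) + 1 ∧ (j : ℕ) + 1 ≤ i + k - 1

instance {n : ℕ} (k i : ℕ) (j : Fin (n - 1)) : Decidable (InBlock k i j) :=
  inferInstanceAs (Decidable (_ ∧ _))

section Coupon

variable {n k : ℕ} {w : ℝ}

/-- A single step of coupon collecting: if every block contains at most one of the given
coordinates, and every one of these is covered with probability `p`, then the generating function
of the number of coordinates left over is bounded as if they were independent. -/
theorem sum_blockProb_mul_pow_le (hw : 0 < w) (hn : k + 2 ≤ n) {R : Finset (Fin (n - 1))}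
    (hR : ∀ i ∈ Finset.Icc 1 (n - k), (R.filter (InBlock k i)).card ≤ 1) {p : ℝ} (hp : 0 ≤ p)
    (hcov : ∀ j ∈ R, ∑ i ∈ Finset.Icc 1 (n - k),
      (if InBlock k i j then blockProb n k w i else 0) = p) {s : ℝ} (hs0 : 0 ≤ s) (hs1 : s ≤ 1) :
    ∑ i ∈ Finset.Icc 1 (n - k), blockProb n k w i *
      s ^ (R.filter fun j => ¬ InBlock k i j).card ≤ (s + p * (1 - s)) ^ R.card := by
  have hsum := sum_blockProb hw hn
  rcases Nat.eq_zero_or_pos R.card with h0 | h0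
  · have hRe := Finset.card_eq_zero.1 h0
    subst hRe
    simp [hsum]
  · obtain ⟨m, hm⟩ : ∃ m, R.card = m + 1 := ⟨R.card - 1, by omega⟩
    -- A block removes zero or one coordinate, so the power of `s` is affine in the number removed.
    have hterm : ∀ i ∈ Finset.Icc 1 (n - k), blockProb n k w i *
        s ^ (R.filter fun j => ¬ InBlock k i j).card = blockProb n k w i * s ^ (m + 1) +
          (∑ j ∈ R, if InBlock k i j then blockProb n k w i else 0) * ((1 - s) * s ^ m) := by
      intro i hi
      have h1 := Finset.card_filter_add_card_filter_not (s := R) (InBlock k i)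
      have h2 := hR i hi
      rw [← Finset.sum_filter, Finset.sum_const, nsmul_eq_mul]
      rcases Nat.le_one_iff_eq_zero_or_eq_one.1 h2 with h3 | h3
      · rw [h3, show (R.filter fun j => ¬ InBlock k i j).card = m + 1 by omega]
        simp
      · rw [h3, show (R.filter fun j => ¬ InBlock k i j).card = m by omega]
        push_cast
        ring
    rw [Finset.sum_congr rfl hterm, Finset.sum_add_distrib, ← Finset.sum_mul, ← Finset.sum_mul,
      hsum, Finset.sum_comm, Finset.sum_congr rfl hcov, Finset.sum_const, hm, nsmul_eq_mul]
    have := pow_succ_add_mul_le_add_pow hs0 (mul_nonneg hp (sub_nonneg.2 hs1)) m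
    push_cast
    calc _ = s ^ (m + 1) + ((m : ℝ) + 1) * (p * (1 - s)) * s ^ m := by ring
      _ ≤ _ := this

/-- `R'` collects coordinates known to be still untouched. The bound is the chance that one of them
survives if each did so independently with probability `(1 - p) ^ t`. The induction closes because
`s ↦ s + p * (1 - s)` sends `1 - (1 - p) ^ t` to `1 - (1 - p) ^ (t + 1)`. -/
theorem one_sub_pow_le_iterate_blockOp {π : ℕ → ℝ} (hw : 0 < w) (hn : k + 2 ≤ n)
    (hπ : IsFullDistribution n π) {R : Finset (Fin (n - 1))}
    (hR : ∀ i ∈ Finset.Icc 1 (n - k), (R.filter (InBlock k i)).card ≤ 1) {p : ℝ} (hp : 0 ≤ p)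
    (hp1 : p ≤ 1) (hcov : ∀ j ∈ R, ∑ i ∈ Finset.Icc 1 (n - k),
      (if InBlock k i j then blockProb n k w i else 0) = p) (x : Fin (n - 1) → ℝ) (t : ℕ) :
    ∀ R' ⊆ R, ∀ y ∈ bdPolytope n π, (∀ j ∈ R', y j = x j) →
      ENNReal.ofReal (1 - (1 - (1 - p) ^ t) ^ R'.card) ≤
        (blockOp n k w π)^[t] (Set.indicator {y | ∃ j ∈ R, y j = x j} 1) y := by
  induction t with
  | zero =>
    intro R' hR' y _ hyx
    rcases Finset.eq_empty_or_nonempty R' with rfl | ⟨j, hj⟩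
    · simp
    · have hmem : y ∈ {y : Fin (n - 1) → ℝ | ∃ j ∈ R, y j = x j} := ⟨j, hR' hj, hyx j hj⟩
      rw [Function.iterate_zero, id, Set.indicator_of_mem hmem]
      refine ENNReal.ofReal_le_one.2 (sub_le_self _ (pow_nonneg ?_ _))
      simp
  | succ t ih =>
    intro R' hR' y hy hyx
    have hs1 : 1 - (1 - p) ^ t ≤ 1 := sub_le_self _ (pow_nonneg (by linarith) t)
    have hs0 : 0 ≤ 1 - (1 - p) ^ t := sub_nonneg.2 (pow_le_one₀ (by linarith) (by linarith))
    have hstep := sum_blockProb_mul_pow_le hw hn (R := R')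
      (fun i hi => (Finset.card_le_card (Finset.filter_subset_filter _ hR')).trans (hR i hi)) hp
      (fun j hj => hcov j (hR' hj)) hs0 hs1
    have heq : 1 - (1 - p) ^ t + p * (1 - (1 - (1 - p) ^ t)) = 1 - (1 - p) ^ (t + 1) := by ring
    rw [heq] at hstep
    rw [Function.iterate_succ_apply', blockOp_apply k w hπ]
    calc _ ≤ ENNReal.ofReal (∑ i ∈ Finset.Icc 1 (n - k), blockProb n k w i *
          (1 - (1 - (1 - p) ^ t) ^ (R'.filter fun j => ¬ InBlock k i j).card)) := by
          refine ENNReal.ofReal_le_ofReal ?_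
          simp only [mul_sub, mul_one, Finset.sum_sub_distrib]
          rw [sum_blockProb hw hn]
          linarith
      _ = ∑ i ∈ Finset.Icc 1 (n - k), ENNReal.ofReal (blockProb n k w i) * ENNReal.ofReal
          (1 - (1 - (1 - p) ^ t) ^ (R'.filter fun j => ¬ InBlock k i j).card) := by
          rw [ENNReal.ofReal_sum_of_nonneg fun i _ => mul_nonneg (blockProb_nonneg hw hn i)
            (sub_nonneg.2 (pow_le_one₀ hs0 hs1))]
          exact Finset.sum_congr rfl fun i _ => ENNReal.ofReal_mul (blockProb_nonneg hw hn i)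
      _ ≤ _ := by
          refine Finset.sum_le_sum fun i _ => ?_
          gcongr
          rw [← body_bdConstraints hπ] at hy
          set v := ENNReal.ofReal
            (1 - (1 - (1 - p) ^ t) ^ (R'.filter fun j => ¬ InBlock k i j).card) with hv
          have hconst : v = ∫⁻ _, v ∂(bdConstraints n π hπ).gibbs (block n k i) y := by
            rw [lintegral_const, gibbs_univ hy, mul_one]
          rw [hconst]
          refine lintegral_mono_ae (ae_gibbs.mono fun z hz => ?_)
          refine ih _ ((Finset.filter_subset _ _).trans hR') z
            (by rw [← body_bdConstraints hπ]; exact hz.1) fun j hj => ?_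
          rw [Finset.mem_filter] at hj
          rw [hz.2 j hj.2, hyx j hj.1]

theorem bdUniform_agree_eq_zero {π : ℕ → ℝ} (R : Finset (Fin (n - 1))) (x : Fin (n - 1) → ℝ) :
    bdUniform n π {y | ∃ j ∈ R, y j = x j} = 0 := by
  refine cond_absolutelyContinuous ?_
  have : {y : Fin (n - 1) → ℝ | ∃ j ∈ R, y j = x j} = ⋃ j ∈ R, {y | y j = x j} := by
    ext y; simp
  rw [this]
  refine (measure_biUnion_null_iff R.countable_toSet).2 fun j _ => ?_
  exact Measure.pi_hyperplane _ _ _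

/-- The distinguishing event is that some coordinate in `R` still has its starting value; under the
uniform law it is null, being a finite union of hyperplanes. -/
theorem one_sub_pow_le_tvDist {π : ℕ → ℝ} (hw : 0 < w) (hn : k + 2 ≤ n)
    (hπ : IsFullDistribution n π) {R : Finset (Fin (n - 1))}
    (hR : ∀ i ∈ Finset.Icc 1 (n - k), (R.filter (InBlock k i)).card ≤ 1) {p : ℝ} (hp : 0 ≤ p)
    (hp1 : p ≤ 1) (hcov : ∀ j ∈ R, ∑ i ∈ Finset.Icc 1 (n - k),
      (if InBlock k i j then blockProb n k w i else 0) = p) {x : Fin (n - 1) → ℝ}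
    (hx : x ∈ bdPolytope n π) (t : ℕ) :
    1 - (1 - (1 - p) ^ t) ^ R.card ≤ tvDist (blockLaw n k w π x t) (bdUniform n π) := by
  have := isProbabilityMeasure_bdUniform hπ
  have huniv := blockLaw_univ_le_one hw hn hπ x t
  set A := {y : Fin (n - 1) → ℝ | ∃ j ∈ R, y j = x j} with hA
  have hAm : MeasurableSet A := by
    have : A = ⋃ j ∈ R, {y | y j = x j} := by
      ext y; simp [hA]
    rw [this]
    exact Finset.measurableSet_biUnion _ fun j _ =>
      measurableSet_eq_fun (measurable_pi_apply j) measurable_const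
  have hbdd : BddAbove (Set.range fun A : {A : Set (Fin (n - 1) → ℝ) // MeasurableSet A} =>
      |(blockLaw n k w π x t).real A.1 - (bdUniform n π).real A.1|) := by
    refine ⟨1, ?_⟩
    rintro _ ⟨A, rfl⟩
    exact abs_real_sub_le_one huniv prob_le_one A.1
  refine le_trans ?_ (le_ciSup hbdd ⟨A, hAm⟩)
  have h1 := one_sub_pow_le_iterate_blockOp hw hn hπ hR hp hp1 hcov x t R subset_rfl x hx
    fun _ _ => rfl
  rw [← lintegral_blockLaw k w hπ x t (measurable_one.indicator hAm),
    lintegral_indicator_one hAm] at h1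
  have h2 : (bdUniform n π).real A = 0 := by
    rw [Measure.real, bdUniform_agree_eq_zero, ENNReal.toReal_zero]
  simp only [h2, sub_zero]
  refine le_trans ?_ (le_abs_self _)
  have h3 : blockLaw n k w π x t A ≠ ∞ := ne_top_of_le_ne_top ENNReal.one_ne_top
    ((measure_mono (Set.subset_univ A)).trans huniv)
  exact (ENNReal.ofReal_le_iff_le_toReal h3).1 h1

/-- Coordinates at mutual distance at least `k`, away from the ends. -/
def spacedCoords (n k : ℕ) (hk : 0 < k) : Finset (Fin (n - 1)) :=
  -- These are the multiples of `k` without the first and the last, so that no end block reaches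
  -- them; `- 1` converts a coordinate to its index.
  Finset.univ.image fun m : Fin ((n - 1) / k - 2) => ⟨k * (m + 2) - 1, by
    have h1 : k * ((m : ℕ) + 2) ≤ k * ((n - 1) / k) := Nat.mul_le_mul_left k (by omega)
    have h2 := Nat.mul_div_le (n - 1) k
    have h3 : 0 < k * ((m : ℕ) + 2) := by positivity
    omega⟩

theorem card_spacedCoords (hk : 0 < k) : (spacedCoords n k hk).card = (n - 1) / k - 2 := by
  rw [spacedCoords, Finset.card_image_of_injective, Finset.card_univ, Fintype.card_fin]
  intro m m' h
  rw [Fin.mk.injEq] at h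
  have h1 : 0 < k * ((m : ℕ) + 2) := by positivity
  have h2 : 0 < k * ((m' : ℕ) + 2) := by positivity
  have h3 := Nat.eq_of_mul_eq_mul_left hk (show k * ((m : ℕ) + 2) = k * ((m' : ℕ) + 2) by omega)
  exact Fin.ext (by omega)

theorem mem_spacedCoords {hk : 0 < k} {j : Fin (n - 1)} (hj : j ∈ spacedCoords n k hk) :
    ∃ m, (j : ℕ) + 1 = k * m ∧ 2 * k ≤ (j : ℕ) + 1 ∧ (j : ℕ) + 1 + k ≤ n - 1 := by
  obtain ⟨m, -, rfl⟩ := Finset.mem_image.1 hj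
  have h1 : k * ((m : ℕ) + 2 + 1) ≤ k * ((n - 1) / k) := Nat.mul_le_mul_left k (by omega)
  have h2 := Nat.mul_div_le (n - 1) k
  have h3 : 0 < k * ((m : ℕ) + 2) := by positivity
  have h4 : 2 * k ≤ k * ((m : ℕ) + 2) := by nlinarith
  rw [mul_add k ((m : ℕ) + 2), mul_one] at h1
  refine ⟨m + 2, ?_, ?_, ?_⟩ <;> simp only <;> omega

theorem card_filter_spacedCoords_le (hk : 0 < k) (i : ℕ) :
    ((spacedCoords n k hk).filter (InBlock k i)).card ≤ 1 := by
  refine Finset.card_le_one.2 fun j hj l hl => ?_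
  rw [Finset.mem_filter] at hj hl
  obtain ⟨hj1, hj2, hj3⟩ := hj
  obtain ⟨hl1, hl2, hl3⟩ := hl
  obtain ⟨m, hm, -, -⟩ := mem_spacedCoords hj1
  obtain ⟨m', hm', -, -⟩ := mem_spacedCoords hl1
  have key : ∀ {m m' : ℕ}, k * m < k * m' + k → m ≤ m' := by
    intro m m' h
    by_contra! hlt
    have := Nat.mul_le_mul_left k (Nat.succ_le_of_lt hlt)
    rw [Nat.succ_eq_add_one, mul_add, mul_one] at this
    omega
  have h1 := key (m := m) (m' := m') (by omega)
  have h2 := key (m := m') (m' := m) (by omega)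
  have h3 : m = m' := le_antisymm h1 h2
  subst h3
  exact Fin.ext (by omega)

/-- Exactly `k` blocks contain such a coordinate and none is an end block, so `w` enters through the
normalisation only. -/
theorem cover_spacedCoords {hk : 0 < k} {j : Fin (n - 1)} (hj : j ∈ spacedCoords n k hk) :
    ∑ i ∈ Finset.Icc 1 (n - k), (if InBlock k i j then blockProb n k w i else 0) =
      k / ((n : ℝ) - k - 2 + 2 * w) := by
  obtain ⟨-, -, h1, h2⟩ := mem_spacedCoords hj
  have hset : (Finset.Icc 1 (n - k)).filter (fun i => InBlock k i j) =
      Finset.Icc ((j : ℕ) + 2 - k) (j + 1) := by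
    ext i
    rw [Finset.mem_filter, Finset.mem_Icc, Finset.mem_Icc, InBlock]
    omega
  rw [← Finset.sum_filter, hset, Finset.sum_congr rfl
    (g := fun _ => 1 / ((n : ℝ) - k - 2 + 2 * w)) fun i hi => ?_]
  · rw [Finset.sum_const, Nat.card_Icc, show (j : ℕ) + 1 + 1 - (j + 2 - k) = k by omega,
      nsmul_eq_mul, mul_one_div]
  · rw [Finset.mem_Icc] at hi
    rw [blockProb, if_neg (by omega)]

end Coupon

/-! ### Asymptotics of the lower bound -/

/-- For times below `(1/k - c) n log n`, a coordinate is likely not to have been resampled. -/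
theorem eventually_one_le_mul_pow {k : ℕ} (hk : 0 < k) {w c : ℝ} (hw : 0 < w) (hc : 0 < c) :
    ∀ᶠ n : ℕ in atTop, k / ((n : ℝ) - k - 2 + 2 * w) ≤ 1 ∧ 1 ≤ (((n - 1) / k - 2 : ℕ) : ℝ) *
      (1 - k / ((n : ℝ) - k - 2 + 2 * w)) ^ ⌊(1 / (k : ℝ) - c) * n * Real.log n⌋₊ := by
  have hk0 : (0 : ℝ) < k := by exact_mod_cast hk
  -- Truncated at `0` because the natural floor of a negative number is `0`.
  set γ := max 0 (1 / (k : ℝ) - c) with hγ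
  have hγ0 : 0 ≤ γ := le_max_left _ _
  have hkγ : k * γ < 1 := by
    rw [mul_comm, ← lt_div_iff₀ hk0]
    exact max_lt (by positivity) (by linarith)
  -- Strictly between `k * γ` and `1`: a given coordinate survives with probability at least `n ^
  -- (-η)`, and `n ^ (1 - η)` eventually exceeds `2 * k`.
  set η := (1 + k * γ) / 2 with hη
  have hη1 : η < 1 := by rw [hη]; linarith
  have hcast : Tendsto (fun n : ℕ => (n : ℝ)) atTop atTop := tendsto_natCast_atTop_atTop
  have hpow : ∀ᶠ n : ℕ in atTop, 2 * (k : ℝ) ≤ (n : ℝ) ^ (1 - η) :=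
    ((tendsto_rpow_atTop (by linarith)).comp hcast).eventually_ge_atTop _
  filter_upwards [hpow, hcast.eventually_ge_atTop (2 * (2 * k + 2) / (1 - k * γ)),
    hcast.eventually_ge_atTop (2 * (k * 4)), hcast.eventually_ge_atTop (2 * k + 3)]
    with n h1 h2 h3 h4
  have hn0 : (0 : ℝ) < n := by linarith
  have hlog : 0 ≤ Real.log n := Real.log_nonneg (by linarith)
  set Z := (n : ℝ) - k - 2 + 2 * w with hZ
  have hZk : 0 < Z - k := by rw [hZ]; linarith
  have hZ0 : 0 < Z := by linarith
  set a := 1 - k / Z with ha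
  have haeq : a = (Z - k) / Z := by rw [ha]; field_simp
  have ha0 : 0 < a := by rw [haeq]; positivity
  refine ⟨by rw [div_le_one hZ0]; linarith, ?_⟩
  set t := ⌊(1 / (k : ℝ) - c) * n * Real.log n⌋₊ with ht
  have ht1 : (t : ℝ) ≤ γ * n * Real.log n := by
    have hle : (1 / (k : ℝ) - c) * n * Real.log n ≤ γ * n * Real.log n := by
      gcongr
      exact le_max_right _ _
    exact (Nat.cast_le.2 (Nat.floor_le_floor hle)).trans (Nat.floor_le (by positivity))
  have hkt : (t : ℝ) * (k / (Z - k)) ≤ η * Real.log n := by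
    rw [← mul_div_assoc, div_le_iff₀ hZk]
    have h5 : k * γ * n ≤ η * (Z - k) := by
      rw [div_le_iff₀ (by linarith)] at h2
      have h6 : (n : ℝ) - (2 * k + 2) ≤ Z - k := by rw [hZ]; linarith
      have h7 : η * ((n : ℝ) - (2 * k + 2)) ≤ η * (Z - k) :=
        mul_le_mul_of_nonneg_left h6 (by positivity)
      have h8 : η * (2 * k + 2) ≤ 1 * (2 * (k : ℝ) + 2) := by gcongr
      have h9 : η * (n : ℝ) - k * γ * n = n * (1 - k * γ) / 2 := by rw [hη]; ring
      linarith
    calc (t : ℝ) * k ≤ γ * n * Real.log n * k := by gcongr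
      _ = k * γ * n * Real.log n := by ring
      _ ≤ η * (Z - k) * Real.log n := by gcongr
      _ = _ := by ring
  have hat : (n : ℝ) ^ (-η) ≤ a ^ t := by
    rw [Real.rpow_def_of_pos hn0, ← Real.exp_log (pow_pos ha0 t), Real.log_pow]
    refine Real.exp_le_exp.2 ?_
    have h5 := Real.one_sub_inv_le_log_of_pos ha0
    have h6 : 1 - a⁻¹ = -(k / (Z - k)) := by
      rw [haeq]
      field_simp
      ring
    rw [h6] at h5
    have h7 := mul_le_mul_of_nonneg_left h5 (Nat.cast_nonneg (α := ℝ) t)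
    linarith
  have hM : (n : ℝ) / (2 * k) ≤ (((n - 1) / k - 2 : ℕ) : ℝ) := by
    have h5 : n ≤ k * ((n - 1) / k) + k := by
      have := Nat.div_add_mod (n - 1) k
      have := Nat.mod_lt (n - 1) hk
      omega
    have h6 : (n : ℝ) ≤ k * (((n - 1) / k : ℕ) : ℝ) + k := by exact_mod_cast h5
    have h7 : (((n - 1) / k : ℕ) : ℝ) ≤ (((n - 1) / k - 2 : ℕ) : ℝ) + 2 := by
      exact_mod_cast (by omega : (n - 1) / k ≤ (n - 1) / k - 2 + 2)
    rw [div_le_iff₀ (by positivity)]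
    nlinarith
  calc (1 : ℝ) ≤ (n : ℝ) ^ (1 - η) / (2 * k) := by rwa [le_div_iff₀ (by positivity), one_mul]
    _ = n / (2 * k) * (n : ℝ) ^ (-η) := by
        rw [sub_eq_add_neg, Real.rpow_add hn0, Real.rpow_one]
        ring
    _ ≤ _ := by gcongr

/-- Before time `(1/k - c) n log n` the block Gibbs sampler is not mixed. -/
theorem liminf_tvDist_blockLaw_pos {k : ℕ} {w c : ℝ} {π : ℕ → ℕ → ℝ}
    {x : (n : ℕ) → Fin (n - 1) → ℝ} (hk : 0 < k) (hw : 0 < w) (hc : 0 < c)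
    (hπ : ∀ n, k < n → IsFullDistribution n (π n)) (hx : ∀ n, k < n → x n ∈ bdPolytope n (π n)) :
    0 < liminf (fun n : ℕ =>
      tvDist (blockLaw n k w (π n) (x n) ⌊(1 / (k : ℝ) - c) * n * Real.log n⌋₊)
        (bdUniform n (π n))) atTop := by
  have hlow : ∀ᶠ n : ℕ in atTop, 1 - Real.exp (-1) ≤
      tvDist (blockLaw n k w (π n) (x n) ⌊(1 / (k : ℝ) - c) * n * Real.log n⌋₊)
        (bdUniform n (π n)) := by
    filter_upwards [eventually_one_le_mul_pow hk hw hc, eventually_ge_atTop (k + 2)]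
      with n ⟨hp1, h1⟩ hn
    have hn' : ((k + 2 : ℕ) : ℝ) ≤ n := by exact_mod_cast hn
    push_cast at hn'
    set p := (k : ℝ) / ((n : ℝ) - k - 2 + 2 * w) with hp
    have hp0 : 0 ≤ p := div_nonneg (Nat.cast_nonneg k) (by linarith)
    refine le_trans ?_ (one_sub_pow_le_tvDist hw hn (hπ n (by omega))
      (R := spacedCoords n k hk) (fun i _ => card_filter_spacedCoords_le hk i) hp0 hp1
      (fun j hj => cover_spacedCoords hj) (hx n (by omega)) _)
    rw [card_spacedCoords]
    set t := ⌊(1 / (k : ℝ) - c) * n * Real.log n⌋₊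
    have h2 : (1 - (1 - p) ^ t) ^ ((n - 1) / k - 2) ≤ Real.exp (-1) := by
      calc _ ≤ Real.exp (-(1 - p) ^ t) ^ ((n - 1) / k - 2) := by
            refine pow_le_pow_left₀ ?_ (Real.one_sub_le_exp_neg _) _
            exact sub_nonneg.2 (pow_le_one₀ (by linarith) (by linarith))
        _ = Real.exp ((((n - 1) / k - 2 : ℕ) : ℝ) * -(1 - p) ^ t) := (Real.exp_nat_mul _ _).symm
        _ ≤ _ := Real.exp_le_exp.2 (by linarith)
    linarith
  -- The eventual lower bound passes to a real `liminf` only for a sequence that is also bounded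
  -- above in the sense of `IsCoboundedUnder`.
  have hup : ∀ᶠ n : ℕ in atTop,
      tvDist (blockLaw n k w (π n) (x n) ⌊(1 / (k : ℝ) - c) * n * Real.log n⌋₊)
        (bdUniform n (π n)) ≤ 1 := by
    filter_upwards [eventually_ge_atTop (k + 2)] with n hn
    have := isProbabilityMeasure_bdUniform (hπ n (by omega))
    exact tvDist_le fun A _ => abs_real_sub_le_one
      (blockLaw_univ_le_one hw hn (hπ n (by omega)) _ _) prob_le_one A
  refine lt_of_lt_of_le ?_ (le_liminf_of_le (isBoundedUnder_of_eventually_le hup).isCoboundedUnder_ge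
    hlow)
  rw [sub_pos, Real.exp_lt_one_iff]
  norm_num

theorem theorem2 :
    (∀ (n : ℕ) (π : ℕ → ℝ) (x : Fin (n - 1) → ℝ) (c : ℝ) (t : ℕ),
      58 < n → IsFullDistribution n π → x ∈ bdPolytope n π →
      0 < c → 2 * c * n * Real.log n < t →
      tvDist (blockLaw n 55 55 π x t) (bdUniform n π) ≤ (n : ℝ) ^ (1 - c)) ∧
    (∀ (k : ℕ) (w c : ℝ) (π : ℕ → ℕ → ℝ) (x : (n : ℕ) → Fin (n - 1) → ℝ),
      0 < k → 0 < w → 0 < c →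
      (∀ n, k < n → IsFullDistribution n (π n)) →
      (∀ n, k < n → x n ∈ bdPolytope n (π n)) →
      0 < liminf (fun n : ℕ =>
        tvDist (blockLaw n k w (π n) (x n) ⌊(1 / (k : ℝ) - c) * n * Real.log n⌋₊)
          (bdUniform n (π n))) atTop) :=
  ⟨fun _ _ _ _ _ hn hπ hx _ ht => tvDist_blockLaw_le_rpow hn hπ hx ht,
    fun _ _ _ _ _ hk hw hc hπ hx => liminf_tvDist_blockLaw_pos hk hw hc hπ hx⟩
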